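/- Let $X$ be a compact (Hausdorff) connected abelian topological group of finite (Lebesgue covering) dimension, let $m$ be the normalized Haar measure on $X$, and let $T_1,\dots,T_s$ be epimorphisms of $X$, i.e. continuous surjective homomorphisms $X\to X$ (not assumed to commute). Then there exists an integer $l\ge 1$ such that for every $k\in\mathbb{Z}/l\mathbb{Z}$ and all complex-valued $f_1,\dots,f_s\in L^\infty(X)=L^\infty(X,m)$, the limit $$\lim_{\substack{n\to\infty\\ n\equiv k\ (\mathrm{mod}\ l)}}\int_X f_1(T_1^{n}x)\cdots f_s(T_s^{n}x)\,dm(x)$$ exists (in $\mathbb{C}$). -/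

import Mathlib

open MeasureTheory Filter Topology

/-- `X` has (Lebesgue) covering dimension at most `d`: every finite open cover of `X` has a finite
open refinement, covering `X`, such that every point of `X` lies in at most `d + 1` of its
members. -/
def CoveringDimLE (X : Type*) [TopologicalSpace X] (d : ℕ) : Prop :=
  ∀ 𝒰 : Set (Set X), 𝒰.Finite → (∀ U ∈ 𝒰, IsOpen U) → ⋃₀ 𝒰 = Set.univ →
    ∃ 𝒱 : Set (Set X), 𝒱.Finite ∧ (∀ V ∈ 𝒱, IsOpen V) ∧ ⋃₀ 𝒱 = Set.univ ∧
      (∀ V ∈ 𝒱, ∃ U ∈ 𝒰, V ⊆ U) ∧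
      ∀ x : X, {V | V ∈ 𝒱 ∧ x ∈ V}.encard ≤ (d : ℕ∞) + 1

/-- The (Lebesgue) covering dimension of a nonempty space `X`: the least `d` such that
`CoveringDimLE X d`, and `⊤` if there is no such `d`. -/
noncomputable def coveringDim (X : Type*) [TopologicalSpace X] : ℕ∞ :=
  ⨅ (d : ℕ) (_ : CoveringDimLE X d), (d : ℕ∞)

/-! Write Γ for the dual group, additively. If the f_i are characters χ_i, the integrand at time n
is the single character Ψ(n) = ∑ (T_i^*)^n χ_i, so the integral is 1 when Ψ(n) = 0 and 0 otherwise.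
Bounded functions reduce to characters by L¹ approximation of one factor at a time
(`exists_tendsto_of_characters`). What is needed is an l, independent of the χ_i, such that on each
class mod l the sequence Ψ has finitely many zeros or vanishes throughout.

Γ is torsion-free because X is connected, has finite rank because X has finite dimension, and each
T_i^* is injective because T_i is onto. So a Skolem–Mahler–Lech argument applies
(`exists_period_of_finite_rank`). Over ℚ the T_i^* become invertible matrices. Choose an odd prime p
dividing no denominator of these matrices or their inverses, and let l be the order of GL over 𝔽_p.
Their l-th powers are 1 mod p, so on a class mod l the coordinates of Ψ are p-adic binomial series,
which vanish once they have infinitely many zeros (`sum_choose_mul_pow_eq_zero`).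

The rank bound `not_linearIndependent_of_coveringDimLE` is a degree argument. N = d + 1 independent
characters χ_i give σ : ℝ^N → X along which χ_i is exp of the i-th coordinate. Take a partition of
unity ρ_V subordinate to a fine cover of order at most N, and glue local logarithms of χ_i with it
into functions h_i. With averaged partial derivatives D_j along σ, the matrix 1 + (D_j h_i) equals
∑_V a_{iV} D_j ρ_V, where a_{iV} is the local logarithm on V. It is singular everywhere: at most N
sets are active at a point and ∑_V D_j ρ_V = 0. Yet its determinant has integral 1, being a null
Lagrangian (`integralCM_det_derivMatrix`).

Two facts of duality are proved on the way. Characters separate points, by Gelfand theory for the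
algebra of translations and correlations (`exists_character_ne_one`). Every homomorphism from Γ to
the circle is an evaluation, by Riesz products (`exists_forall_character_eq`). -/

/-! ### Gelfand theory: characters of commutative Banach algebras. -/

/-- An element of a commutative complex Banach algebra whose powers do not decay faster than
geometrically is detected by a character. -/
theorem exists_characterSpace_apply_ne_zero {A : Type*} [NormedCommRing A] [NormedAlgebra ℂ A]
    [CompleteSpace A] (b : A) {c r : ℝ} (hc : 0 < c) (hr : 0 < r)
    (h : ∀ k : ℕ, c * r ^ (2 ^ k) ≤ ‖b ^ (2 ^ k)‖) :
    ∃ ω : WeakDual.characterSpace ℂ A, ω b ≠ 0 := by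
  -- Gelfand's formula along the subsequence 2 ^ k shows that the spectral radius is at least `r`.
  have hlim : Tendsto (fun k : ℕ => ENNReal.ofReal (‖b ^ (2 ^ k)‖ ^ (1 / ((2 ^ k : ℕ) : ℝ)))) atTop
      (𝓝 (spectralRadius ℂ b)) :=
    (spectrum.pow_norm_pow_one_div_tendsto_nhds_spectralRadius b).comp
      (tendsto_pow_atTop_atTop_of_one_lt one_lt_two)
  have hlim2 : Tendsto (fun k : ℕ => ENNReal.ofReal (c ^ (1 / ((2 ^ k : ℕ) : ℝ)) * r)) atTop
      (𝓝 (ENNReal.ofReal r)) := by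
    have h0 : Tendsto (fun k : ℕ => (1 / ((2 ^ k : ℕ) : ℝ))) atTop (𝓝 0) :=
      tendsto_one_div_atTop_nhds_zero_nat.comp (tendsto_pow_atTop_atTop_of_one_lt one_lt_two)
    have h1 : Tendsto (fun k : ℕ => c ^ (1 / ((2 ^ k : ℕ) : ℝ)) * r) atTop (𝓝 r) := by
      have := (tendsto_const_nhds (x := c)).rpow h0 (Or.inl hc.ne')
      simpa using this.mul_const r
    exact (ENNReal.continuous_ofReal.tendsto _).comp h1
  have hle : ENNReal.ofReal r ≤ spectralRadius ℂ b := by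
    refine le_of_tendsto_of_tendsto' hlim2 hlim fun k => ENNReal.ofReal_le_ofReal ?_
    have hpos : (0 : ℝ) < ((2 ^ k : ℕ) : ℝ) := by positivity
    calc c ^ (1 / ((2 ^ k : ℕ) : ℝ)) * r
        = (c * r ^ (2 ^ k)) ^ (1 / ((2 ^ k : ℕ) : ℝ)) := by
          rw [Real.mul_rpow hc.le (by positivity), ← Real.rpow_natCast r, ← Real.rpow_mul hr.le,
            mul_one_div_cancel hpos.ne', Real.rpow_one]
      _ ≤ _ := Real.rpow_le_rpow (by positivity) (h k) (by positivity)
  have hpos : 0 < spectralRadius ℂ b := lt_of_lt_of_le (by simpa using hr) hle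
  obtain ⟨z, hz, hz0⟩ : ∃ z ∈ spectrum ℂ b, z ≠ 0 := by
    by_contra! hcon
    refine hpos.ne' ?_
    simp only [spectralRadius, ENNReal.iSup_eq_zero]
    intro z hz
    simp [hcon z hz]
  obtain ⟨ω, hω⟩ := WeakDual.CharacterSpace.mem_spectrum_iff_exists.1 hz
  exact ⟨ω, by rwa [hω]⟩

/-- A version of `exists_characterSpace_apply_ne_zero` for a commutative subalgebra of a Banach
algebra. -/
theorem exists_algHom_adjoin_apply_ne_zero {R : Type*} [NormedRing R] [NormOneClass R]
    [NormedAlgebra ℂ R]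
    [CompleteSpace R] (S : Set R) (hS : ∀ a ∈ S, ∀ b ∈ S, a * b = b * a)
    (b : Algebra.adjoin ℂ S) {c r : ℝ} (hc : 0 < c) (hr : 0 < r)
    (h : ∀ k : ℕ, c * r ^ (2 ^ k) ≤ ‖(b : R) ^ (2 ^ k)‖) :
    ∃ ω : Algebra.adjoin ℂ S →ₐ[ℂ] ℂ, (∀ a, ‖ω a‖ ≤ ‖(a : R)‖) ∧ ω b ≠ 0 := by
  let s := Algebra.adjoin ℂ S
  have hs : ∀ x y : s, x * y = y * x := (Algebra.isMulCommutative_adjoin ℂ hS).is_comm.comm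
  let A := s.topologicalClosure
  let _ : NormedCommRing A :=
    { (inferInstance : NormedRing A) with
      mul_comm := (s.commRingTopologicalClosure hs).mul_comm }
  have : CompleteSpace A := s.isClosed_topologicalClosure.completeSpace_coe
  let ι : s →ₐ[ℂ] A := Subalgebra.inclusion s.le_topologicalClosure
  obtain ⟨ω, hω⟩ := exists_characterSpace_apply_ne_zero (ι b) hc hr (fun k => h k)
  refine ⟨(WeakDual.CharacterSpace.toAlgHom ω).comp ι, fun a => ?_, hω⟩
  have : NormOneClass A := ⟨norm_one (α := R)⟩
  exact AlgHom.norm_apply_le_self (WeakDual.CharacterSpace.toAlgHom ω) (ι a)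

/-- A function version of `exists_algHom_adjoin_apply_ne_zero`. -/
theorem exists_multiplicative_apply_ne_zero {R : Type*} [NormedRing R] [NormOneClass R]
    [NormedAlgebra ℂ R] [CompleteSpace R] (S : Set R) (hS : ∀ a ∈ S, ∀ b ∈ S, a * b = b * a)
    {p q : R} (hp : p ∈ S) (hq : q ∈ S) {c r : ℝ} (hc : 0 < c) (hr : 0 < r)
    (h : ∀ k : ℕ, c * r ^ (2 ^ k) ≤ ‖(p * q) ^ (2 ^ k)‖) :
    ∃ ω : R → ℂ, ω 1 = 1 ∧ ω q ≠ 0 ∧ (∀ a ∈ S, ‖ω a‖ ≤ ‖a‖) ∧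
      (∀ a ∈ S, ∀ b ∈ S, ω (a * b) = ω a * ω b) ∧
      ∀ a ∈ S, ∀ b ∈ S, ω (a - b) = ω a - ω b := by
  classical
  have hsub : S ⊆ Algebra.adjoin ℂ S := Algebra.subset_adjoin
  obtain ⟨ω, hω, hωb⟩ := exists_algHom_adjoin_apply_ne_zero S hS (⟨p, hsub hp⟩ * ⟨q, hsub hq⟩)
    hc hr h
  -- Extension by the junk value 0 outside the subalgebra; only values on the subalgebra are used.
  obtain ⟨Ω, hext⟩ : ∃ Ω : R → ℂ, ∀ a : Algebra.adjoin ℂ S, Ω a = ω a :=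
    ⟨fun a => if ha : a ∈ Algebra.adjoin ℂ S then ω ⟨a, ha⟩ else 0, fun a => by simp⟩
  refine ⟨Ω, (hext 1).trans (map_one ω), fun h0 => hωb ?_, fun a ha => ?_,
    fun a ha b hb => ?_, fun a ha b hb => ?_⟩
  · rw [map_mul, ← hext ⟨q, hsub hq⟩, h0, mul_zero]
  · exact (congrArg norm (hext ⟨a, hsub ha⟩)).trans_le (hω _)
  · have := hext (⟨a, hsub ha⟩ * ⟨b, hsub hb⟩)
    rwa [map_mul, ← hext, ← hext] at this
  · have := hext (⟨a, hsub ha⟩ - ⟨b, hsub hb⟩)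
    rwa [map_sub, ← hext, ← hext] at this

/-! ### Translations and correlation operators on C(X). -/

section Translate

variable {X : Type*} [CommGroup X] [TopologicalSpace X] [IsTopologicalGroup X] [CompactSpace X]

/-- Translation `f ↦ f (· * a)` on continuous functions. -/
noncomputable def mulTranslate (a : X) : C(X, ℂ) →L[ℂ] C(X, ℂ) :=
  LinearMap.mkContinuous
    { toFun := fun f => f.comp ⟨fun x => x * a, continuous_mul_const a⟩
      map_add' := fun _ _ => rfl
      map_smul' := fun _ _ => rfl } 1 fun f => by
    rw [one_mul, ContinuousMap.norm_le _ (norm_nonneg _)]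
    exact fun x => f.norm_coe_le_norm _

@[simp] theorem mulTranslate_apply (a : X) (f : C(X, ℂ)) (x : X) : mulTranslate a f x = f (x * a) := rfl

theorem norm_mulTranslate_le (a : X) : ‖(mulTranslate a : C(X, ℂ) →L[ℂ] C(X, ℂ))‖ ≤ 1 :=
  LinearMap.mkContinuous_norm_le _ zero_le_one _

theorem mulTranslate_mul (a b : X) :
    (mulTranslate (a * b) : C(X, ℂ) →L[ℂ] C(X, ℂ)) = mulTranslate a * mulTranslate b := by
  ext f x
  simp [mul_assoc]

theorem mulTranslate_one : (mulTranslate (1 : X) : C(X, ℂ) →L[ℂ] C(X, ℂ)) = 1 := by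
  ext f x
  simp

theorem continuous_mulTranslate_apply (f : C(X, ℂ)) : Continuous fun a : X => mulTranslate a f :=
  (ContinuousMap.curry ⟨fun p : X × X => f (p.2 * p.1), by fun_prop⟩).continuous

variable [T2Space X] [MeasurableSpace X] [BorelSpace X] (m : Measure X) [IsProbabilityMeasure m]

theorem integrable_of_continuous {E : Type*} [NormedAddCommGroup E] {f : X → E}
    (hf : Continuous f) : Integrable f m :=
  hf.integrable_of_hasCompactSupport (HasCompactSupport.of_compactSpace f)

theorem norm_integral_le_of_norm_le_of_continuous {E : Type*} [NormedAddCommGroup E]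
    [NormedSpace ℝ E] {f : X → E} {C : ℝ} (h : ∀ x, ‖f x‖ ≤ C) : ‖∫ x, f x ∂m‖ ≤ C := by
  simpa using norm_integral_le_of_norm_le_const (μ := m) (Eventually.of_forall h)

theorem integrable_smul_mulTranslate (f g : C(X, ℂ)) :
    Integrable (fun y => f y • mulTranslate y g) m :=
  integrable_of_continuous m (f.continuous.smul (continuous_mulTranslate_apply g))

/-- The correlation operator `g ↦ (x ↦ ∫ f y * g (x * y) ∂m)` on continuous functions. -/
noncomputable def corr (f : C(X, ℂ)) : C(X, ℂ) →L[ℂ] C(X, ℂ) :=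
  LinearMap.mkContinuous
    { toFun := fun g => ∫ y, f y • mulTranslate y g ∂m
      map_add' := fun g h => by
        rw [← integral_add (integrable_smul_mulTranslate m f g) (integrable_smul_mulTranslate m f h)]
        simp
      map_smul' := fun c g => by
        rw [RingHom.id_apply, ← integral_smul]
        simp [smul_comm c] } ‖f‖ fun g => by
    refine norm_integral_le_of_norm_le_of_continuous m fun y => ?_
    rw [norm_smul]
    gcongr
    · exact f.norm_coe_le_norm y
    · simpa using (mulTranslate y).le_of_opNorm_le (norm_mulTranslate_le y) g

theorem corr_apply (f g : C(X, ℂ)) (x : X) : corr m f g x = ∫ y, f y * g (x * y) ∂m := by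
  have := (ContinuousMap.evalCLM ℂ x).integral_comp_comm (integrable_smul_mulTranslate m f g)
  exact this.symm

theorem norm_corr_le (f : C(X, ℂ)) : ‖corr m f‖ ≤ ‖f‖ :=
  LinearMap.mkContinuous_norm_le _ (norm_nonneg _) _

theorem corr_sub (f g : C(X, ℂ)) : corr m (f - g) = corr m f - corr m g := by
  ext h x
  simp only [corr_apply, ContinuousMap.sub_apply, sub_mul, sub_apply]
  exact integral_sub (integrable_of_continuous m (by fun_prop))
    (integrable_of_continuous m (by fun_prop))

theorem integral_integral_swap_of_continuous {F : X → X → ℂ} (hF : Continuous F.uncurry) :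
    ∫ x, ∫ y, F x y ∂m ∂m = ∫ y, ∫ x, F x y ∂m ∂m :=
  integral_integral_swap_of_hasCompactSupport hF (HasCompactSupport.of_compactSpace _)

theorem corr_mul_comm (f g : C(X, ℂ)) : corr m f * corr m g = corr m g * corr m f := by
  ext h x
  simp only [mul_apply_eq_comp, corr_apply, ← integral_const_mul]
  rw [integral_integral_swap_of_continuous m (by fun_prop)]
  congr! 4 with y z
  rw [mul_right_comm x, mul_left_comm]

theorem mulTranslate_mul_corr_comm (a : X) (f : C(X, ℂ)) :
    mulTranslate a * corr m f = corr m f * mulTranslate a := by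
  ext g x
  simp [corr_apply, mul_assoc, mul_comm a]

variable [m.IsHaarMeasure]

/-- Invariance of `m` under y ↦ y * a. Applying a multiplicative functional to this identity
expresses its value at a translation through its values at correlations, which are norm-continuous
in the function; this is how the resulting character becomes continuous. -/
theorem mulTranslate_mul_corr (a : X) (f : C(X, ℂ)) :
    mulTranslate a * corr m f = corr m (mulTranslate a⁻¹ f) := by
  ext g x
  simp only [mul_apply_eq_comp, corr_apply, mulTranslate_apply]
  rw [← integral_mul_right_eq_self (fun y => f (y * a⁻¹) * g (x * y)) a]
  refine integral_congr_ae (Eventually.of_forall fun y => ?_)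
  simp [mul_right_comm x a y, mul_assoc]

/-- The function `y ↦ conj (f y⁻¹)`. -/
noncomputable def starInv (f : C(X, ℂ)) : C(X, ℂ) := ⟨fun y => star (f y⁻¹), by fun_prop⟩

/-- Fubini together with the substitutions x ↦ x * y⁻¹ and y ↦ y⁻¹. It identifies the L² adjoint of
a correlation operator, so that `corr m (starInv u) * corr m u` is positive. -/
theorem integral_star_mul_corr (f g h : C(X, ℂ)) :
    ∫ x, star (h x) * corr m f g x ∂m = ∫ x, star (corr m (starInv f) h x) * g x ∂m := by
  simp only [corr_apply, ← integral_const_mul]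
  rw [integral_integral_swap_of_continuous m (by fun_prop)]
  have h1 : ∀ y, ∫ x, star (h x) * (f y * g (x * y)) ∂m =
      ∫ x, star (h (x * y⁻¹)) * (f y * g x) ∂m := fun y => by
    rw [← integral_mul_right_eq_self (fun x => star (h (x * y⁻¹)) * (f y * g x)) y]
    simp
  simp only [h1]
  rw [← integral_inv_eq_self _ m, integral_integral_swap_of_continuous m (by fun_prop)]
  congr! 2 with x
  have h2 : star (∫ y, starInv f y * h (x * y) ∂m) = ∫ y, star (starInv f y * h (x * y)) ∂m :=
    integral_conj.symm
  rw [h2, ← integral_mul_const]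
  congr! 2 with y
  simp [starInv]
  ring

end Translate

/-! ### Characters separate points. -/

section Separate

variable {X : Type*} [CommGroup X] [TopologicalSpace X] [IsTopologicalGroup X] [CompactSpace X]
  [T2Space X] [MeasurableSpace X] [BorelSpace X] (m : Measure X) [IsProbabilityMeasure m]
  [m.IsHaarMeasure]

/-- The inner product `∫ conj h * g` on continuous functions. -/
noncomputable def innerInt (h g : C(X, ℂ)) : ℂ := ∫ x, star (h x) * g x ∂m

theorem innerInt_self (h : C(X, ℂ)) : innerInt m h h = ((∫ x, ‖h x‖ ^ 2 ∂m : ℝ) : ℂ) := by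
  rw [innerInt, ← integral_complex_ofReal]
  congr! 2 with x
  simp [Complex.conj_mul']

theorem integral_norm_sq_pos {h : C(X, ℂ)} (hh : h ≠ 0) : 0 < ∫ x, ‖h x‖ ^ 2 ∂m := by
  obtain ⟨x, hx⟩ := DFunLike.ne_iff.1 hh
  exact Continuous.integral_pos_of_hasCompactSupport_nonneg_nonzero (by fun_prop)
    (HasCompactSupport.of_compactSpace _) (fun _ => by positivity) (x := x) (by simpa using hx)

theorem norm_innerInt_le (h g : C(X, ℂ)) : ‖innerInt m h g‖ ≤ ‖h‖ * ‖g‖ :=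
  norm_integral_le_of_norm_le_of_continuous m fun x => by
    rw [norm_mul, norm_star]
    gcongr <;> apply ContinuousMap.norm_coe_le_norm

theorem norm_innerInt_sq_le (h g : C(X, ℂ)) :
    ‖innerInt m h g‖ ^ 2 ≤ (∫ x, ‖h x‖ ^ 2 ∂m) * ∫ x, ‖g x‖ ^ 2 ∂m := by
  have h1 : ‖innerInt m h g‖ ≤ ∫ x, ‖h x‖ * ‖g x‖ ∂m := by
    refine (norm_integral_le_integral_norm _).trans_eq ?_
    simp
  have h2 := integral_mul_le_Lp_mul_Lq_of_nonneg (μ := m) (f := fun x => ‖h x‖)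
    (g := fun x => ‖g x‖) Real.HolderConjugate.two_two
    (Eventually.of_forall fun x => norm_nonneg _) (Eventually.of_forall fun x => norm_nonneg _)
    (MemLp.of_bound (C := ‖h‖) (Continuous.aestronglyMeasurable (by fun_prop))
      (Eventually.of_forall fun x => by simpa using h.norm_coe_le_norm x))
    (MemLp.of_bound (C := ‖g‖) (Continuous.aestronglyMeasurable (by fun_prop))
      (Eventually.of_forall fun x => by simpa using g.norm_coe_le_norm x))
  have h3 : 0 ≤ ∫ x, ‖h x‖ ^ 2 ∂m := integral_nonneg fun _ => by positivity
  have h4 : 0 ≤ ∫ x, ‖g x‖ ^ 2 ∂m := integral_nonneg fun _ => by positivity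
  simp only [← Real.sqrt_eq_rpow, Real.rpow_two] at h2
  calc ‖innerInt m h g‖ ^ 2 ≤ (√(∫ x, ‖h x‖ ^ 2 ∂m) * √(∫ x, ‖g x‖ ^ 2 ∂m)) ^ 2 := by
        gcongr; exact h1.trans h2
    _ = _ := by rw [mul_pow, Real.sq_sqrt h3, Real.sq_sqrt h4]

theorem innerInt_corr (f g h : C(X, ℂ)) :
    innerInt m h (corr m f g) = innerInt m (corr m (starInv f) h) g :=
  integral_star_mul_corr m f g h

theorem starInv_starInv (f : C(X, ℂ)) : starInv (starInv f) = f := by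
  ext x
  simp [starInv]

/-- Powers of the positive operator `corr (starInv u) * corr u` grow at least geometrically. -/
theorem exists_le_norm_pow_corr {u : C(X, ℂ)} (hu : u ≠ 0) :
    ∃ c r : ℝ, 0 < c ∧ 0 < r ∧
      ∀ k : ℕ, c * r ^ (2 ^ k) ≤ ‖(corr m (starInv u) * corr m u) ^ (2 ^ k)‖ := by
  set B := corr m (starInv u) * corr m u with hB
  -- This test vector gives `corr m u v 1` = ∫ |u|² > 0, hence ⟨v, B v⟩ = ‖corr u v‖² > 0 in L².
  let v : C(X, ℂ) := star u
  have hv : v ≠ 0 := by simpa [v] using hu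
  have hsymm : ∀ h g, innerInt m h (B g) = innerInt m (B h) g := fun h g => by
    rw [hB, mul_apply_eq_comp, innerInt_corr, innerInt_corr, starInv_starInv, mul_apply_eq_comp]
  have hsymm' : ∀ n h g, innerInt m h ((B ^ n) g) = innerInt m ((B ^ n) h) g := fun n => by
    induction n with
    | zero => simp
    | succ n ih =>
      intro h g
      rw [pow_succ, mul_apply_eq_comp, ih, hsymm, ← mul_apply_eq_comp, ← pow_succ', pow_succ]
  set a0 : ℝ := ∫ x, ‖v x‖ ^ 2 ∂m with ha0
  have ha0pos : 0 < a0 := integral_norm_sq_pos m hv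
  have hw : corr m u v ≠ 0 := fun h => by
    have h1 : corr m u v 1 = ((∫ x, ‖u x‖ ^ 2 ∂m : ℝ) : ℂ) := by
      rw [corr_apply, ← integral_complex_ofReal]
      congr! 2 with x
      simp [v, Complex.mul_conj']
    rw [h, ContinuousMap.zero_apply] at h1
    exact (integral_norm_sq_pos m hu).ne' (by exact_mod_cast h1.symm)
  set b1 : ℝ := ‖innerInt m v (B v)‖ with hb1
  have hb1pos : 0 < b1 := by
    rw [hb1, hB, mul_apply_eq_comp, innerInt_corr, starInv_starInv, innerInt_self, norm_pos_iff]
    exact_mod_cast (integral_norm_sq_pos m hw).ne'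
  -- Doubling the exponent: ⟨v, B^(2n) v⟩ = ‖B^n v‖² by symmetry, and Cauchy–Schwarz bounds this
  -- below by |⟨v, B^n v⟩|² / ‖v‖².
  have key : ∀ k : ℕ, a0 * (b1 / a0) ^ (2 ^ k) ≤ ‖innerInt m v ((B ^ (2 ^ k)) v)‖ := fun k => by
    induction k with
    | zero => simp [mul_div_cancel₀, ha0pos.ne', hb1]
    | succ k ih =>
      have h1 := norm_innerInt_sq_le m v ((B ^ (2 ^ k)) v)
      have h2 : ‖innerInt m v ((B ^ (2 ^ (k + 1))) v)‖ = ∫ x, ‖(B ^ (2 ^ k)) v x‖ ^ 2 ∂m := by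
        rw [pow_succ 2 k, mul_two, pow_add, mul_apply_eq_comp, hsymm', innerInt_self,
          Complex.norm_real, Real.norm_of_nonneg (integral_nonneg fun _ => by positivity)]
      rw [h2]
      have h3 := (pow_le_pow_left₀ (by positivity) ih 2).trans h1
      rw [mul_pow, ← pow_mul, ← pow_succ, sq a0, mul_assoc] at h3
      exact le_of_mul_le_mul_left h3 ha0pos
  have hvn : 0 < ‖v‖ := norm_pos_iff.2 hv
  refine ⟨a0 / (‖v‖ * ‖v‖), b1 / a0, by positivity, by positivity, fun k => ?_⟩
  rw [div_mul_eq_mul_div, div_le_iff₀ (by positivity)]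
  calc _ ≤ _ := key k
    _ ≤ ‖v‖ * ‖(B ^ (2 ^ k)) v‖ := norm_innerInt_le m _ _
    _ ≤ ‖v‖ * (‖B ^ (2 ^ k)‖ * ‖v‖) := by gcongr; exact ContinuousLinearMap.le_opNorm _ _
    _ = _ := by ring

/-- For `u ≠ 0` there is a joint eigenvalue system of the translations and correlation operators
which does not vanish at `corr m u`. -/
theorem exists_joint_eigenvalue (m : Measure X) [IsProbabilityMeasure m] [m.IsHaarMeasure]
    {u : C(X, ℂ)} (hu : u ≠ 0) :
    ∃ (φ : X → ℂ) (ψ : C(X, ℂ) → ℂ), φ 1 = 1 ∧ (∀ x y, φ (x * y) = φ x * φ y) ∧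
      (∀ x, ‖φ x‖ ≤ 1) ∧ ψ u ≠ 0 ∧ (∀ x g, φ x * ψ g = ψ (mulTranslate x⁻¹ g)) ∧
      (∀ g h, ψ (g - h) = ψ g - ψ h) ∧ ∀ g, ‖ψ g‖ ≤ ‖g‖ := by
  obtain ⟨c, r, hc, hr, hcr⟩ := exists_le_norm_pow_corr m hu
  let S : Set (C(X, ℂ) →L[ℂ] C(X, ℂ)) := Set.range mulTranslate ∪ Set.range (corr m)
  have hS : ∀ p ∈ S, ∀ q ∈ S, p * q = q * p := by
    rintro _ (⟨x, rfl⟩ | ⟨g, rfl⟩) _ (⟨y, rfl⟩ | ⟨h, rfl⟩)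
    · rw [← mulTranslate_mul, mul_comm, mulTranslate_mul]
    · exact mulTranslate_mul_corr_comm m x h
    · exact (mulTranslate_mul_corr_comm m y g).symm
    · exact corr_mul_comm m g h
  have hτ : ∀ x, mulTranslate x ∈ S := fun x => Or.inl ⟨x, rfl⟩
  have hκ : ∀ g, corr m g ∈ S := fun g => Or.inr ⟨g, rfl⟩
  obtain ⟨ω, h1, hq, hle, hmul, hsub⟩ := exists_multiplicative_apply_ne_zero S hS
    (hκ (starInv u)) (hκ u) hc hr hcr
  refine ⟨fun x => ω (mulTranslate x), fun g => ω (corr m g), ?_, fun x y => ?_, fun x => ?_, hq,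
    fun x g => ?_, fun g h => ?_, fun g => ?_⟩
  · beta_reduce
    rw [mulTranslate_one, h1]
  · beta_reduce
    rw [mulTranslate_mul, hmul _ (hτ x) _ (hτ y)]
  · exact (hle _ (hτ x)).trans (norm_mulTranslate_le x)
  · rw [← hmul _ (hτ x) _ (hκ g), mulTranslate_mul_corr]
  · beta_reduce
    rw [corr_sub, hsub _ (hκ g) _ (hκ h)]
  · exact (hle _ (hκ g)).trans (norm_corr_le m g)

/-- The characters of a compact abelian group separate points. -/
theorem exists_character_ne_one (m : Measure X) [IsProbabilityMeasure m] [m.IsHaarMeasure] {a : X}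
    (ha : a ≠ 1) : ∃ χ : X →ₜ* Circle, χ a ≠ 1 := by
  obtain ⟨f, hf⟩ : ∃ f : C(X, ℂ), mulTranslate a⁻¹ f ≠ f := by
    obtain ⟨f, h0, h1, -⟩ := exists_continuous_zero_one_of_isClosed (isClosed_singleton (x := a⁻¹))
      (isClosed_singleton (x := (1 : X))) (by simpa using ha)
    refine ⟨⟨fun x => (f x : ℂ), by fun_prop⟩, fun h => ?_⟩
    have h2 := DFunLike.congr_fun h 1
    have h3 : f a⁻¹ = 0 := h0 rfl
    have h4 : f 1 = 1 := h1 rfl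
    simp [h3, h4] at h2
  -- With this `u`, the eigenvalue relation reads ψ u = (1 - φ a) ψ f, so ψ u ≠ 0 forces φ a ≠ 1.
  set u := f - mulTranslate a⁻¹ f with hu
  obtain ⟨φ, ψ, hone, hmul, hle, hψu, hφψ, hψsub, hψle⟩ :=
    exists_joint_eigenvalue m (sub_ne_zero.2 hf.symm)
  -- φ is multiplicative and bounded by 1 at both x and x⁻¹.
  have hnorm : ∀ x, ‖φ x‖ = 1 := fun x => by
    refine le_antisymm (hle x) ?_
    have : ‖φ x‖ * ‖φ x⁻¹‖ = 1 := by rw [← norm_mul, ← hmul]; simp [hone]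
    nlinarith [hle x, hle x⁻¹, norm_nonneg (φ x), norm_nonneg (φ x⁻¹)]
  have hψcont : Continuous ψ := by
    refine LipschitzWith.continuous (K := 1) (LipschitzWith.of_dist_le_mul fun g h => ?_)
    rw [dist_eq_norm, dist_eq_norm, ← hψsub, NNReal.coe_one, one_mul]
    exact hψle _
  have hcont : Continuous φ := by
    have : φ = fun x => ψ (mulTranslate x⁻¹ u) / ψ u := by
      ext x
      rw [← hφψ, mul_div_cancel_right₀ _ hψu]
    rw [this]
    exact (hψcont.comp ((continuous_mulTranslate_apply u).comp continuous_inv)).div_const _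
  refine ⟨⟨⟨⟨fun x => ⟨φ x, mem_sphere_zero_iff_norm.2 (hnorm x)⟩, Subtype.ext hone⟩,
    fun x y => Subtype.ext (hmul x y)⟩, hcont.subtype_mk _⟩, fun h => hψu ?_⟩
  have h1 : φ a = 1 := congrArg Subtype.val h
  rw [hψsub, ← hφψ, h1, one_mul, sub_self]

end Separate

/-! ### Orthogonality of characters and density of trigonometric polynomials. -/

section Dual

variable {X : Type*} [CommGroup X] [TopologicalSpace X] [IsTopologicalGroup X] [CompactSpace X]

/-- A character as a complex-valued continuous function. -/
noncomputable def charCM : (X →ₜ* Circle) →* C(X, ℂ) where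
  toFun χ := ⟨fun x => (χ x : ℂ), by fun_prop⟩
  map_one' := by ext; simp
  map_mul' _ _ := by ext; simp

@[simp] theorem charCM_apply (χ : X →ₜ* Circle) (x : X) : charCM χ x = χ x := rfl

theorem star_charCM (χ : X →ₜ* Circle) : star (charCM χ) = charCM χ⁻¹ := by
  ext x
  exact (Circle.coe_inv_eq_conj (χ x)).symm

variable [MeasurableSpace X] [BorelSpace X] (m : Measure X) [IsProbabilityMeasure m]
  [m.IsHaarMeasure]

/-- Translating by a point where χ ≠ 1 multiplies the integral by a number different from 1. -/
theorem integral_charCM_of_ne_one {χ : X →ₜ* Circle} (h : χ ≠ 1) : ∫ x, (χ x : ℂ) ∂m = 0 := by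
  obtain ⟨a, ha⟩ := DFunLike.ne_iff.1 h
  have h1 : ∫ x, (χ (x * a) : ℂ) ∂m = ∫ x, (χ x : ℂ) ∂m :=
    integral_mul_right_eq_self (fun x => (χ x : ℂ)) a
  simp only [map_mul, Circle.coe_mul, integral_mul_const] at h1
  by_contra h0
  exact ha (Circle.ext ((mul_eq_left₀ h0).1 h1))

variable [T2Space X]

theorem character_separates (m : Measure X) [IsProbabilityMeasure m] [m.IsHaarMeasure]
    {x y : X} (h : ∀ χ : X →ₜ* Circle, χ x = χ y) : x = y := by
  by_contra hxy
  obtain ⟨χ, hχ⟩ := exists_character_ne_one m (a := x / y) (by rwa [ne_eq, div_eq_one])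
  exact hχ (by rw [map_div, h, div_self'])

/-- Trigonometric polynomials are dense in the continuous functions. -/
theorem topologicalClosure_span_charCM (m : Measure X) [IsProbabilityMeasure m]
    [m.IsHaarMeasure] :
    (Submodule.span ℂ (Set.range (charCM (X := X)))).topologicalClosure = ⊤ := by
  let s : Submodule ℂ C(X, ℂ) := Submodule.span ℂ (Set.range (charCM (X := X)))
  have hmul : ∀ f g, f ∈ s → g ∈ s → f * g ∈ s := fun f g hf hg => by
    have : s * s ≤ s := by
      rw [Submodule.span_mul_span]
      refine Submodule.span_mono ?_
      rintro _ ⟨_, ⟨χ, rfl⟩, _, ⟨ψ, rfl⟩, rfl⟩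
      exact ⟨χ * ψ, map_mul _ _ _⟩
    exact this (Submodule.mul_mem_mul hf hg)
  let A : StarSubalgebra ℂ C(X, ℂ) :=
    { s.toSubalgebra (Submodule.subset_span ⟨1, map_one _⟩) hmul with
      star_mem' := fun {f} hf => by
        refine Submodule.span_induction (p := fun f _ => star f ∈ s) ?_ ?_ ?_ ?_ hf
        · rintro _ ⟨χ, rfl⟩
          rw [star_charCM]
          exact Submodule.subset_span ⟨_, rfl⟩
        · simp
        · intro f g _ _ hf hg
          rw [star_add]
          exact s.add_mem hf hg
        · intro c f _ hf
          rw [star_smul]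
          exact s.smul_mem _ hf }
  have hA : A.topologicalClosure = ⊤ := by
    refine ContinuousMap.starSubalgebra_topologicalClosure_eq_top_of_separatesPoints A ?_
    intro x y hxy
    by_contra! h
    refine hxy (character_separates m fun χ => Circle.ext ?_)
    exact h _ ⟨charCM χ, Submodule.subset_span ⟨χ, rfl⟩, rfl⟩
  refine SetLike.coe_injective ?_
  exact congrArg (fun B : StarSubalgebra ℂ C(X, ℂ) => (B : Set C(X, ℂ))) hA

theorem dense_span_charCM (m : Measure X) [IsProbabilityMeasure m] [m.IsHaarMeasure] :
    Dense (Submodule.span ℂ (Set.range (charCM (X := X))) : Set C(X, ℂ)) :=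
  Submodule.dense_iff_topologicalClosure_eq_top.2 (topologicalClosure_span_charCM m)

end Dual

/-! ### Homomorphisms from the dual group to the circle are evaluations. -/

section Evaluation

variable {X : Type*} [CommGroup X] [TopologicalSpace X] [IsTopologicalGroup X] [CompactSpace X]
  [T2Space X] [MeasurableSpace X] [BorelSpace X] (m : Measure X) [IsProbabilityMeasure m]
  [m.IsHaarMeasure]

theorem Circle.one_add_re_div_two_mem (z : Circle) : (1 + (z : ℂ).re) / 2 ∈ Set.Icc (0 : ℝ) 1 := by
  have h := Complex.abs_re_le_norm (z : ℂ)
  rw [Circle.norm_coe, abs_le] at h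
  constructor <;> linarith [h.1, h.2]

theorem Circle.eq_one_of_re_eq_one {z : Circle} (h : (z : ℂ).re = 1) : z = 1 := by
  have h1 : (z : ℂ).re * (z : ℂ).re + (z : ℂ).im * (z : ℂ).im = 1 := by
    rw [← Complex.normSq_apply, Circle.normSq_coe]
  rw [h] at h1
  have h2 : (z : ℂ).im = 0 := by nlinarith
  exact Circle.ext (Complex.ext (by simpa using h) (by simpa using h2))

/-- The Riesz product `∏ (1 + Re (conj (θ χ) * χ x)) / 2` over a finite set of characters. -/
noncomputable def rieszProd (θ : (X →ₜ* Circle) →* Circle) (F : Finset (X →ₜ* Circle)) (x : X) :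
    ℝ := ∏ χ ∈ F, (1 + (((θ χ)⁻¹ * χ x : Circle) : ℂ).re) / 2

theorem continuous_rieszProd (θ : (X →ₜ* Circle) →* Circle) (F : Finset (X →ₜ* Circle)) :
    Continuous (rieszProd θ F) := by
  unfold rieszProd
  fun_prop

/-- Both integrands are images of one element of the group algebra of the dual, with each χ twisted
by (θ χ)⁻¹. Integration reads off the coefficient of the trivial character, where the twist is 1. -/
theorem integral_rieszProd_pow (θ : (X →ₜ* Circle) →* Circle) (F : Finset (X →ₜ* Circle))
    (M : ℕ) : ∫ x, rieszProd θ F x ^ M ∂m = ∫ x, rieszProd 1 F x ^ M ∂m := by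
  let ev : ((X →ₜ* Circle) →* Circle) → MonoidAlgebra ℂ (X →ₜ* Circle) →ₐ[ℂ] C(X, ℂ) := fun θ =>
    MonoidAlgebra.lift ℂ C(X, ℂ) (X →ₜ* Circle)
      { toFun := fun χ => ((θ χ)⁻¹ : Circle) • charCM χ
        map_one' := by simp
        map_mul' := fun χ ψ => by
          ext x
          simp only [map_mul, mul_inv, ContinuousMap.smul_apply, ContinuousMap.mul_apply,
            Circle.smul_def, Circle.coe_mul, smul_eq_mul]
          ring }
  have hev : ∀ θ χ c x, ev θ (MonoidAlgebra.single χ c) x = c * ((θ χ)⁻¹ * χ x : Circle) :=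
    fun θ χ c x => by simp [ev, Circle.smul_def]
  let p : MonoidAlgebra ℂ (X →ₜ* Circle) := ∏ χ ∈ F,
    (MonoidAlgebra.single 1 (1 / 2) + MonoidAlgebra.single χ (1 / 4) +
      MonoidAlgebra.single χ⁻¹ (1 / 4))
  have hp : ∀ θ x, ev θ p x = rieszProd θ F x := fun θ x => by
    simp only [p, map_prod, rieszProd, ContinuousMap.prod_apply, Complex.ofReal_prod]
    refine Finset.prod_congr rfl fun χ _ => ?_
    have h1 : ((((θ χ)⁻¹ * χ x : Circle) : ℂ).re : ℂ) =
        ((((θ χ)⁻¹ * χ x : Circle) : ℂ) + (((θ χ)⁻¹ * χ x : Circle)⁻¹ : Circle)) / 2 := by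
      rw [Circle.coe_inv_eq_conj, Complex.add_conj]
      push_cast
      ring
    have h2 : ((θ χ⁻¹)⁻¹ * χ⁻¹ x : Circle) = ((θ χ)⁻¹ * χ x)⁻¹ := by
      rw [map_inv, mul_inv]
      rfl
    have h3 : (θ 1)⁻¹ * (1 : X →ₜ* Circle) x = 1 := by simp
    simp only [map_add, ContinuousMap.add_apply, hev, h2, h3]
    generalize (θ χ)⁻¹ * χ x = z at h1
    simp only [Complex.ofReal_div, Complex.ofReal_add, h1, Circle.coe_one, Complex.ofReal_one,
      Complex.ofReal_ofNat]
    ring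
  have hint : ∀ θ q, ∫ x, ev θ q x ∂m = ∫ x, ev 1 q x ∂m := fun θ q => by
    classical
    have hi : ∀ θ q, Integrable (fun x => ev θ q x) m := fun θ q =>
      integrable_of_continuous m (by fun_prop)
    induction q using MonoidAlgebra.induction_linear with
    | zero => simp
    | add q r hq hr =>
      simp only [map_add, ContinuousMap.add_apply]
      rw [integral_add (hi _ _) (hi _ _), integral_add (hi _ _) (hi _ _), hq, hr]
    | single χ c =>
      simp only [hev, Circle.coe_mul, integral_const_mul]
      by_cases h : χ = 1
      · simp [h]
      · simp [integral_charCM_of_ne_one m h]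
  have h := hint θ (p ^ M)
  simp only [map_pow, ContinuousMap.pow_apply, hp, ← Complex.ofReal_pow] at h
  rw [integral_complex_ofReal, integral_complex_ofReal] at h
  exact_mod_cast h

/-- A homomorphism from the dual group to the circle agrees on every finite set with the evaluation
at some point. -/
theorem exists_forall_mem_finset_character_eq (m : Measure X) [IsProbabilityMeasure m]
    [m.IsHaarMeasure] (θ : (X →ₜ* Circle) →* Circle)
    (F : Finset (X →ₜ* Circle)) : ∃ x : X, ∀ χ ∈ F, χ x = θ χ := by
  -- Each factor is at most 1, with equality only where χ x = θ χ, so without a common solution the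
  -- θ-product has maximum β < 1. The untwisted product is 1 at the identity, hence exceeds γ > β on
  -- an open set of positive measure. Equality of the M-th moments fails for large M.
  by_contra! hcon
  have hnn : ∀ θ x, 0 ≤ rieszProd θ F x := fun θ x =>
    Finset.prod_nonneg fun χ _ => (Circle.one_add_re_div_two_mem _).1
  have hlt : ∀ x, rieszProd θ F x < 1 := fun x => by
    obtain ⟨χ, hχ, hne⟩ := hcon x
    have h1 := Circle.one_add_re_div_two_mem ((θ χ)⁻¹ * χ x)
    have h2 : (1 + (((θ χ)⁻¹ * χ x : Circle) : ℂ).re) / 2 ≠ 1 := fun h =>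
      hne (inv_mul_eq_one.1 (Circle.eq_one_of_re_eq_one (by linarith))).symm
    classical
    rw [rieszProd, ← Finset.mul_prod_erase F _ hχ]
    refine lt_of_le_of_lt (mul_le_of_le_one_right h1.1 ?_) (lt_of_le_of_ne h1.2 h2)
    exact Finset.prod_le_one (fun _ _ => (Circle.one_add_re_div_two_mem _).1)
      fun _ _ => (Circle.one_add_re_div_two_mem _).2
  obtain ⟨x0, -, hx0⟩ := isCompact_univ.exists_isMaxOn (Set.univ_nonempty (α := X))
    (continuous_rieszProd θ F).continuousOn
  set β := rieszProd θ F x0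
  have hβ0 : 0 ≤ β := hnn _ _
  have hβ1 : β < 1 := hlt _
  set γ := (β + 1) / 2 with hγ
  have hγ0 : 0 < γ := by positivity
  let U : Set X := {x | γ < rieszProd 1 F x}
  have hU : IsOpen U := isOpen_lt continuous_const (continuous_rieszProd 1 F)
  have hU1 : (1 : X) ∈ U := by
    simp only [U, Set.mem_setOf_eq, rieszProd]
    simp only [MonoidHom.one_apply, map_one, inv_one, mul_one, Circle.coe_one, Complex.one_re]
    norm_num
    linarith
  have hmU : 0 < m.real U := by
    rw [measureReal_def, ENNReal.toReal_pos_iff]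
    exact ⟨hU.measure_pos m ⟨1, hU1⟩, measure_lt_top _ _⟩
  have key : ∀ M : ℕ, m.real U ≤ (β / γ) ^ M := fun M => by
    have h1 : ∫ x, rieszProd θ F x ^ M ∂m ≤ β ^ M := by
      refine (Real.le_norm_self _).trans (norm_integral_le_of_norm_le_of_continuous m fun x => ?_)
      rw [Real.norm_of_nonneg (pow_nonneg (hnn _ _) _)]
      exact pow_le_pow_left₀ (hnn _ _) (hx0 (Set.mem_univ x)) M
    have h2 : γ ^ M * m.real U ≤ ∫ x, rieszProd 1 F x ^ M ∂m := by
      have h3 : ∫ x, U.indicator (fun _ => γ ^ M) x ∂m = γ ^ M * m.real U := by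
        rw [integral_indicator_const _ hU.measurableSet, smul_eq_mul, mul_comm]
      rw [← h3]
      refine integral_mono ((integrable_const _).indicator hU.measurableSet)
        (integrable_of_continuous m ((continuous_rieszProd 1 F).pow M)) fun x => ?_
      by_cases hx : x ∈ U
      · simpa [hx] using pow_le_pow_left₀ hγ0.le (le_of_lt hx) M
      · simpa [hx] using pow_nonneg (hnn 1 x) M
    rw [div_pow, le_div_iff₀ (by positivity), mul_comm]
    exact h2.trans ((integral_rieszProd_pow m θ F M).symm.trans_le h1)
  have hlim : Tendsto (fun M : ℕ => (β / γ) ^ M) atTop (𝓝 0) :=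
    tendsto_pow_atTop_nhds_zero_of_lt_one (by positivity) (by rw [div_lt_one hγ0]; linarith)
  exact absurd (ge_of_tendsto' hlim key) (not_le.2 hmU)

/-- Every homomorphism from the dual group to the circle is the evaluation at a point. -/
theorem exists_forall_character_eq (m : Measure X) [IsProbabilityMeasure m] [m.IsHaarMeasure]
    (θ : (X →ₜ* Circle) →* Circle) : ∃ x : X, ∀ χ : X →ₜ* Circle, χ x = θ χ := by
  have hne := IsCompact.inter_iInter_nonempty (isCompact_univ (X := X))
    (fun χ : X →ₜ* Circle => {x | χ x = θ χ})
    (fun χ => isClosed_eq χ.continuous_toFun continuous_const) fun F => by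
      obtain ⟨x, hx⟩ := exists_forall_mem_finset_character_eq m θ F
      exact ⟨x, Set.mem_univ _, Set.mem_iInter₂.2 hx⟩
  obtain ⟨x, -, hx⟩ := hne
  exact ⟨x, Set.mem_iInter.1 hx⟩

/-- Every homomorphism from the dual group to a finite power of `ℝ` is the derivative of a
continuous family of one-parameter subgroups. -/
theorem exists_hom_of_dual (m : Measure X) [IsProbabilityMeasure m] [m.IsHaarMeasure] {N : ℕ}
    (ℓ : Additive (X →ₜ* Circle) →+ (Fin N → ℝ)) :
    ∃ σ : (Fin N → ℝ) → X, Continuous σ ∧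
      (∀ χ u, χ (σ u) = Circle.exp (∑ j, ℓ (Additive.ofMul χ) j * u j)) ∧
      ∀ u v, σ (u + v) = σ u * σ v := by
  have h1 : ∀ u : Fin N → ℝ, ∃ x : X, ∀ χ : X →ₜ* Circle,
      χ x = Circle.exp (∑ j, ℓ (Additive.ofMul χ) j * u j) := fun u =>
    exists_forall_character_eq m
      { toFun := fun χ => Circle.exp (∑ j, ℓ (Additive.ofMul χ) j * u j)
        map_one' := by simp
        map_mul' := fun χ ψ => by
          simp [add_mul, Finset.sum_add_distrib, Circle.exp_add] }
  choose σ hσ using h1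
  refine ⟨σ, ?_, fun χ u => hσ u χ, fun u v => character_separates m fun χ => ?_⟩
  -- By compactness X carries the topology induced from the product of circles, so continuity is
  -- tested on characters.
  · have hemb : IsClosedEmbedding fun (x : X) (χ : X →ₜ* Circle) => χ x :=
      Continuous.isClosedEmbedding (continuous_pi fun χ => χ.continuous_toFun)
        fun x y hxy => character_separates m fun χ => congrFun hxy χ
    rw [hemb.isEmbedding.continuous_iff]
    refine continuous_pi fun χ => ?_
    simp only [Function.comp_def, hσ]
    fun_prop
  · simp [hσ, mul_add, Finset.sum_add_distrib, Circle.exp_add]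

end Evaluation

/-! ### Replacing coordinates one at a time, and extending maps into a divisible group. -/

/-- To prove a property of families with members in `A`, it suffices to prove it for families with
members in `G`, and to pass from `G` to `A` in one coordinate at a time. -/
theorem forall_family_of_forall_update {ι E : Type*} [Finite ι] [DecidableEq ι]
    (P : (ι → E) → Prop) (A G : Set E) (hGA : G ⊆ A)
    (step : ∀ e, (∀ j, e j ∈ A) → ∀ i, (∀ g ∈ G, P (Function.update e i g)) → P e)
    (base : ∀ e, (∀ i, e i ∈ G) → P e) (e : ι → E) (he : ∀ i, e i ∈ A) : P e := by
  cases nonempty_fintype ι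
  suffices h : ∀ (S : Finset ι) (e : ι → E), (∀ i ∈ S, e i ∈ A) → (∀ i ∉ S, e i ∈ G) → P e from
    h Finset.univ e (fun i _ => he i) (fun i hi => absurd (Finset.mem_univ i) hi)
  intro S
  induction S using Finset.induction_on with
  | empty => exact fun e _ h => base e fun i => h i (Finset.notMem_empty i)
  | insert a S ha ih =>
    intro e h1 h2
    refine step e (fun j => ?_) a fun g hg => ih _ (fun i hi => ?_) fun i hi => ?_
    · by_cases hj : j ∈ insert a S
      · exact h1 j hj
      · exact hGA (h2 j hj)
    · rw [Function.update_of_ne (ne_of_mem_of_not_mem hi ha)]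
      exact h1 i (Finset.mem_insert_of_mem hi)
    · rcases eq_or_ne i a with rfl | hne
      · simpa using hg
      · rw [Function.update_of_ne hne]
        exact h2 i (by simp [hne, hi])

/-- A linearly independent family can be mapped to the standard basis of `ℝ^N`. -/
theorem exists_addMonoidHom_eq_single {A : Type*} [AddCommGroup A] {N : ℕ} {v : Fin N → A}
    (hv : LinearIndependent ℤ v) :
    ∃ ℓ : A →+ (Fin N → ℝ), ∀ i, ℓ (v i) = Pi.single i 1 := by
  obtain ⟨ℓ, hℓ⟩ := (Module.Baer.of_divisible (Fin N → ℝ)).extension_property_addMonoidHom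
    (Finsupp.linearCombination ℤ v).toAddMonoidHom hv
    (Finsupp.linearCombination ℤ fun i : Fin N => (Pi.single i 1 : Fin N → ℝ)).toAddMonoidHom
  refine ⟨ℓ, fun i => ?_⟩
  simpa using DFunLike.congr_fun hℓ (Finsupp.single i 1)

/-! ### Averaged partial derivatives along σ. -/

section GridDeriv

variable {X : Type*} [CommGroup X] [TopologicalSpace X] [IsTopologicalGroup X] [CompactSpace X]
  {N : ℕ}

/-- Lebesgue measure on the unit cube. -/
noncomputable def cubeMeasure (N : ℕ) : Measure (Fin N → ℝ) :=
  Measure.pi fun _ => volume.restrict (Set.Icc 0 1)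

instance : IsProbabilityMeasure (volume.restrict (Set.Icc (0 : ℝ) 1)) :=
  ⟨by simp⟩

instance (N : ℕ) : IsProbabilityMeasure (cubeMeasure N) :=
  inferInstanceAs (IsProbabilityMeasure (Measure.pi _))

theorem ae_cubeMeasure_mem (N : ℕ) : ∀ᵐ t ∂cubeMeasure N, ∀ k, t k ∈ Set.Icc (0 : ℝ) 1 :=
  eventually_all.2 fun k => Measure.tendsto_eval_ae_ae.eventually
    (ae_restrict_mem measurableSet_Icc)

theorem integrable_cubeMeasure {E : Type*} [NormedAddCommGroup E] {f : (Fin N → ℝ) → E}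
    (hf : Continuous f) : Integrable f (cubeMeasure N) := by
  have : cubeMeasure N = volume.restrict (Set.Icc 0 1) := by
    rw [cubeMeasure, ← Set.pi_univ_Icc, volume_pi, Measure.restrict_pi_pi]
    rfl
  rw [this]
  exact hf.continuousOn.integrableOn_compact isCompact_Icc

variable (σ : C(Fin N → ℝ, X)) (δ : ℝ)

/-- The difference of a continuous function between the faces `t j = 1` and `t j = 0` of the cube
with side `δ` along `σ`. -/
noncomputable def faceDiff (j : Fin N) (t : Fin N → ℝ) : C(X, ℂ) →L[ℂ] C(X, ℂ) :=
  mulTranslate (σ (δ • Function.update t j 1)) - mulTranslate (σ (δ • Function.update t j 0))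

theorem continuous_faceDiff_apply (j : Fin N) (f : C(X, ℂ)) :
    Continuous fun t => faceDiff σ δ j t f := by
  refine ((continuous_mulTranslate_apply f).comp ?_).sub
    ((continuous_mulTranslate_apply f).comp ?_)
  all_goals exact σ.continuous.comp ((continuous_id.update j continuous_const).const_smul δ)

/-- The average over the cube with side `δ` along `σ` of the `j`-th partial derivative. -/
noncomputable def gridDeriv (j : Fin N) : C(X, ℂ) →L[ℂ] C(X, ℂ) :=
  LinearMap.mkContinuous
    { toFun := fun f => (δ⁻¹ : ℂ) • ∫ t, faceDiff σ δ j t f ∂cubeMeasure N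
      map_add' := fun f g => by
        rw [← smul_add, ← integral_add (integrable_cubeMeasure (continuous_faceDiff_apply σ δ j f))
          (integrable_cubeMeasure (continuous_faceDiff_apply σ δ j g))]
        simp
      map_smul' := fun c f => by
        simp only [map_smul]
        rw [RingHom.id_apply, integral_smul, smul_comm] } (‖(δ⁻¹ : ℂ)‖ * 2) fun f => by
    change ‖(δ⁻¹ : ℂ) • ∫ t, faceDiff σ δ j t f ∂cubeMeasure N‖ ≤ _
    rw [norm_smul, mul_assoc]
    gcongr
    have h : ∀ t, ‖faceDiff σ δ j t f‖ ≤ 2 * ‖f‖ := fun t => by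
      refine (norm_sub_le _ _).trans ?_
      have h1 : ∀ a : X, ‖mulTranslate a f‖ ≤ ‖f‖ := fun a => by
        simpa using (mulTranslate a).le_of_opNorm_le (norm_mulTranslate_le a) f
      exact (add_le_add (h1 _) (h1 _)).trans_eq (two_mul _).symm
    simpa using norm_integral_le_of_norm_le_const (μ := cubeMeasure N) (Eventually.of_forall h)

theorem gridDeriv_apply (j : Fin N) (f : C(X, ℂ)) (x : X) :
    gridDeriv σ δ j f x = (δ⁻¹ : ℂ) * ∫ t, (f (x * σ (δ • Function.update t j 1)) -
      f (x * σ (δ • Function.update t j 0))) ∂cubeMeasure N := by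
  have := (ContinuousMap.evalCLM ℂ x).integral_comp_comm
    (integrable_cubeMeasure (continuous_faceDiff_apply σ δ j f))
  exact congrArg ((δ⁻¹ : ℂ) * ·) this.symm

/-- Kept free of division so that it also covers c = 0, that is, characters constant in a direction.
-/
theorem integral_exp_Icc (c : ℂ) :
    c * ∫ t in Set.Icc (0 : ℝ) 1, Complex.exp (c * t) = Complex.exp c - 1 := by
  rw [integral_Icc_eq_integral_Ioc, ← intervalIntegral.integral_of_le zero_le_one]
  rcases eq_or_ne c 0 with rfl | hc
  · simp
  · rw [integral_exp_mul_complex hc, mul_div_cancel₀ _ hc]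
    simp

/-- Characters are joint eigenfunctions of the averaged partial derivatives, with eigenvalues
proportional to the derivative of the character along `σ`. -/
theorem exists_gridDeriv_charCM_eq {ℓ : Additive (X →ₜ* Circle) →+ (Fin N → ℝ)}
    (hσ : ∀ χ u, χ (σ u) = Circle.exp (∑ j, ℓ (Additive.ofMul χ) j * u j)) (hδ : δ ≠ 0)
    (χ : X →ₜ* Circle) :
    ∃ κ : ℂ, ∀ j, gridDeriv σ δ j (charCM χ) = (κ * ℓ (Additive.ofMul χ) j) • charCM χ := by
  set w : Fin N → ℝ := ℓ (Additive.ofMul χ)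
  let E : Fin N → ℂ := fun k => ∫ t in Set.Icc (0 : ℝ) 1, Complex.exp (Complex.I * δ * w k * t)
  -- The face difference contributes I * δ * w j * E j and averaging over the other coordinates
  -- contributes the remaining E k. The product over all k is the same for every j, which is what
  -- makes κ independent of j.
  refine ⟨Complex.I * ∏ k, E k, fun j => ?_⟩
  ext x
  have h1 : ∀ (t : Fin N → ℝ) (s : ℝ), charCM χ (x * σ (δ • Function.update t j s)) =
      χ x * (Complex.exp (Complex.I * δ * w j * s) *
        ∏ k, if k = j then 1 else Complex.exp (Complex.I * δ * w k * t k)) := fun t s => by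
    have h2 : ∏ k, (if k = j then 1 else Complex.exp (Complex.I * δ * w k * t k)) =
        ∏ k ∈ Finset.univ.erase j, Complex.exp (Complex.I * δ * w k * t k) := by
      rw [← Finset.mul_prod_erase _ _ (Finset.mem_univ j), if_pos rfl, one_mul]
      exact Finset.prod_congr rfl fun k hk => if_neg (Finset.ne_of_mem_erase hk)
    rw [h2, charCM_apply, map_mul, Circle.coe_mul, hσ, Circle.coe_exp, ← Complex.exp_sum,
      ← Complex.exp_add, ← Finset.add_sum_erase _ _ (Finset.mem_univ j)]
    congr 2
    simp only [Pi.smul_apply, Function.update_self, smul_eq_mul]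
    push_cast
    rw [add_mul, Finset.sum_mul]
    congr 1
    · ring
    · refine Finset.sum_congr rfl fun k hk => ?_
      rw [Function.update_of_ne (Finset.ne_of_mem_erase hk)]
      ring
  have h3 : ∫ t, (∏ k, if k = j then 1 else Complex.exp (Complex.I * δ * w k * t k))
      ∂cubeMeasure N = ∏ k ∈ Finset.univ.erase j, E k := by
    have := integral_fintype_prod_eq_prod (μ := fun _ : Fin N => volume.restrict (Set.Icc (0 : ℝ) 1))
      (fun (k : Fin N) (t : ℝ) => if k = j then 1 else Complex.exp (Complex.I * δ * w k * t))
    rw [cubeMeasure, this, ← Finset.mul_prod_erase _ _ (Finset.mem_univ j)]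
    simp only [if_true, integral_const, probReal_univ, one_smul, one_mul]
    refine Finset.prod_congr rfl fun k hk => ?_
    simp [Finset.ne_of_mem_erase hk, E]
  have h4 := integral_exp_Icc (Complex.I * δ * w j)
  have hδ' : (δ : ℂ) ≠ 0 := by exact_mod_cast hδ
  rw [gridDeriv_apply]
  simp only [h1, ← mul_sub, ← sub_mul, integral_const_mul, h3, ContinuousMap.smul_apply,
    charCM_apply, smul_eq_mul, Complex.ofReal_one, Complex.ofReal_zero, mul_one, mul_zero,
    Complex.exp_zero, ← h4]
  rw [← Finset.mul_prod_erase Finset.univ E (Finset.mem_univ j)]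
  simp only [E]
  field_simp

end GridDeriv

/-! ### The determinant as a null Lagrangian. -/

section DetIntegral

variable {X : Type*} [CommGroup X] [TopologicalSpace X] [IsTopologicalGroup X] [CompactSpace X]
  [T2Space X] [MeasurableSpace X] [BorelSpace X] {N : ℕ}

/-- The matrix with rows `c i + (D j (φ i))_j` for `e i = (c i, φ i)`. -/
noncomputable def derivMatrix (D : Fin N → C(X, ℂ) →L[ℂ] C(X, ℂ))
    (e : Fin N → (Fin N → ℂ) × C(X, ℂ)) : Matrix (Fin N) (Fin N) C(X, ℂ) :=
  Matrix.of fun i j => algebraMap ℂ C(X, ℂ) ((e i).1 j) + D j (e i).2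

variable {D : Fin N → C(X, ℂ) →L[ℂ] C(X, ℂ)} {w : (X →ₜ* Circle) → Fin N → ℂ}

/-- Integration against `m` as a continuous linear functional. -/
noncomputable def integralCM (m : Measure X) [IsProbabilityMeasure m] : C(X, ℂ) →L[ℂ] ℂ :=
  LinearMap.mkContinuous
    { toFun := fun f => ∫ x, f x ∂m
      map_add' := fun f g => integral_add (integrable_of_continuous m f.continuous)
        (integrable_of_continuous m g.continuous)
      map_smul' := fun c f => integral_const_mul c _ } 1 fun f => by
    rw [one_mul]
    exact norm_integral_le_of_norm_le_of_continuous m f.norm_coe_le_norm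

theorem integralCM_apply (m : Measure X) [IsProbabilityMeasure m] (f : C(X, ℂ)) :
    integralCM m f = ∫ x, f x ∂m := rfl

/-- The case of rows which are either constant or gradients of characters. -/
theorem integralCM_det_derivMatrix_of_pure (m : Measure X) [IsProbabilityMeasure m]
    [m.IsHaarMeasure] (hw : ∀ χ ψ, w (χ * ψ) = w χ + w ψ) (κ : (X →ₜ* Circle) → ℂ)
    (hD : ∀ χ j, D j (charCM χ) = (κ χ * w χ j) • charCM χ)
    (e : Fin N → (Fin N → ℂ) × C(X, ℂ))
    (he : ∀ i, (e i).2 = 0 ∨ ((e i).1 = 0 ∧ ∃ χ, (e i).2 = charCM χ)) :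
    integralCM m (derivMatrix D e).det = (Matrix.of fun i => (e i).1).det := by
  classical
  have hw1 : w 1 = 0 := by simpa using hw 1 1
  by_cases hall : ∀ i, (e i).2 = 0
  · have : derivMatrix D e = (algebraMap ℂ C(X, ℂ)).mapMatrix (Matrix.of fun i => (e i).1) := by
      ext i j
      simp [derivMatrix, hall]
    rw [this, ← RingHom.map_det, integralCM_apply]
    simp
  · push Not at hall
    obtain ⟨i0, hi0⟩ := hall
    have hχ : ∀ i, ∃ (χ : X →ₜ* Circle), (e i).2 = 0 ∧ χ = 1 ∨
        (e i).2 ≠ 0 ∧ (e i).1 = 0 ∧ (e i).2 = charCM χ := fun i => by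
      by_cases h : (e i).2 = 0
      · exact ⟨1, Or.inl ⟨h, rfl⟩⟩
      · obtain ⟨h1, χ, h2⟩ := (he i).resolve_left h
        exact ⟨χ, Or.inr ⟨h, h1, h2⟩⟩
    choose χ hχ using hχ
    let W : Matrix (Fin N) (Fin N) ℂ :=
      Matrix.of fun i => if (e i).2 = 0 then (e i).1 else w (χ i)
    let K : Fin N → ℂ := fun i => if (e i).2 = 0 then 1 else κ (χ i)
    -- Each row is a character (trivial for a constant row) times a scalar times a constant row, so
    -- the determinant is a constant multiple of the character ∏ χ i.
    have hmat : derivMatrix D e = Matrix.of fun i j =>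
        (charCM (χ i) * algebraMap ℂ C(X, ℂ) (K i)) * (algebraMap ℂ C(X, ℂ)).mapMatrix W i j := by
      ext i j x
      rcases hχ i with ⟨h1, h2⟩ | ⟨h1, h2, h3⟩
      · simp [derivMatrix, W, K, h1, h2]
      · have h4 : charCM (χ i) ≠ 0 := h3 ▸ h1
        simp [derivMatrix, W, K, h2, h3, hD, h4]
        ring
    have hdet0 : (Matrix.of fun i => (e i).1).det = 0 := by
      refine Matrix.det_eq_zero_of_row_eq_zero i0 fun j => ?_
      rcases hχ i0 with ⟨h1, h2⟩ | ⟨h1, h2, h3⟩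
      · exact absurd h1 hi0
      · simp [h2]
    rw [hmat, Matrix.det_mul_column, ← RingHom.map_det, hdet0, Finset.prod_mul_distrib,
      ← map_prod, ← map_prod, mul_assoc, ← map_mul, mul_comm, ← Algebra.smul_def, map_smul,
      smul_eq_mul, mul_eq_zero]
    -- If the product is trivial, the gradient rows w (χ i) add up to w 1 = 0 and the constant
    -- matrix is singular; otherwise the character integrates to 0.
    by_cases hprod : ∏ i, χ i = 1
    · left
      have hW : W.det = 0 := by
        refine Matrix.exists_vecMul_eq_zero_iff.1
          ⟨fun i => if (e i).2 = 0 then 0 else 1, fun h => ?_, ?_⟩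
        · simpa [hi0] using congrFun h i0
        · have h1 : ∀ i, (if (e i).2 = 0 then (0 : ℂ) else 1) • W i = w (χ i) := fun i => by
            rcases hχ i with ⟨h1, h2⟩ | ⟨h1, h2, h3⟩
            · simp [h1, h2, hw1]
            · rw [if_neg h1, one_smul]
              exact if_neg h1
          have h2 : ∀ S : Finset (Fin N), ∑ i ∈ S, w (χ i) = w (∏ i ∈ S, χ i) := fun S => by
            induction S using Finset.induction_on with
            | empty => simp [hw1]
            | insert a S ha ih => rw [Finset.sum_insert ha, Finset.prod_insert ha, hw, ih]
          rw [Matrix.vecMul_eq_sum, Finset.sum_congr rfl fun i _ => h1 i, h2, hprod, hw1]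
      rw [hW, mul_zero]
    · right
      exact integral_charCM_of_ne_one m hprod

/-- If the operators `D j` act on characters like multiples of derivations, then the determinant
of a Jacobian matrix `1 + (D j (φ i))` has integral one. -/
theorem integralCM_det_derivMatrix (m : Measure X) [IsProbabilityMeasure m]
    [m.IsHaarMeasure] (hw : ∀ χ ψ, w (χ * ψ) = w χ + w ψ) (κ : (X →ₜ* Circle) → ℂ)
    (hD : ∀ χ j, D j (charCM χ) = (κ χ * w χ j) • charCM χ)
    (e : Fin N → (Fin N → ℂ) × C(X, ℂ)) :
    integralCM m (derivMatrix D e).det = (Matrix.of fun i => (e i).1).det := by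
  classical
  refine forall_family_of_forall_update
    (fun e => integralCM m (derivMatrix D e).det = (Matrix.of fun i => (e i).1).det)
    Set.univ {p | p.2 = 0 ∨ (p.1 = 0 ∧ ∃ χ, p.2 = charCM χ)} (Set.subset_univ _)
    (fun e _ i hP => ?_) (fun e he => integralCM_det_derivMatrix_of_pure m hw κ hD e he) e
    fun _ => Set.mem_univ _
  let row : (Fin N → ℂ) × C(X, ℂ) →ₗ[ℂ] (Fin N → C(X, ℂ)) := LinearMap.pi fun j =>
    (Algebra.linearMap ℂ C(X, ℂ)) ∘ₗ (LinearMap.proj j) ∘ₗ (LinearMap.fst ℂ _ _) +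
      (D j : C(X, ℂ) →ₗ[ℂ] C(X, ℂ)) ∘ₗ (LinearMap.snd ℂ _ _)
  have hrow : ∀ p, derivMatrix D (Function.update e i p) =
      (derivMatrix D e).updateRow i (row p) := fun p => by
    ext i' j
    rcases eq_or_ne i' i with rfl | h
    · simp [derivMatrix, row]
    · simp [derivMatrix, h]
  have hcst : ∀ p : (Fin N → ℂ) × C(X, ℂ),
      (Matrix.of fun i' => (Function.update e i p i').1) =
      (Matrix.of fun i' => (e i').1).updateRow i p.1 := fun p => by
    ext i' j
    rcases eq_or_ne i' i with rfl | h
    · simp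
    · simp [h]
  simp only [hrow, hcst] at hP
  -- The defect of the identity as a linear functional of the i-th row. It is continuous in the
  -- function component, so vanishing on characters propagates to all of C(X).
  let M : (Fin N → ℂ) × C(X, ℂ) →ₗ[ℂ] ℂ :=
    { toFun := fun p => integralCM m ((derivMatrix D e).updateRow i (row p)).det -
        ((Matrix.of fun i' => (e i').1).updateRow i p.1).det
      map_add' := fun p q => by
        simp only [map_add, Matrix.det_updateRow_add, Prod.fst_add]
        ring
      map_smul' := fun c p => by
        simp only [map_smul, Prod.smul_fst, Matrix.det_updateRow_smul, RingHom.id_apply]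
        have : c • row p = (algebraMap ℂ C(X, ℂ) c) • row p := by
          ext j x
          simp
        rw [this, Matrix.det_updateRow_smul, smul_eq_mul, ← Algebra.smul_def, map_smul]
        simp only [smul_eq_mul]
        ring }
  have hM : ∀ f, M (0, f) = 0 := fun f => by
    have hcont : Continuous fun f => M (0, f) := by
      refine ((integralCM m).continuous.comp (Continuous.matrix_det ?_)).sub ?_
      swap
      · dsimp only
        exact continuous_const
      refine Continuous.matrix_updateRow i continuous_const (continuous_pi fun j => ?_)
      simp only [row, LinearMap.pi_apply]
      simp
      fun_prop
    have hz : Set.EqOn (fun f => M (0, f)) 0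
        (Submodule.span ℂ (Set.range (charCM (X := X))) : Set C(X, ℂ)) := fun f hf => by
      refine Submodule.span_induction (p := fun f _ => M (0, f) = 0) ?_ ?_ ?_ ?_ hf
      · rintro _ ⟨χ, rfl⟩
        exact sub_eq_zero.2 (hP (0, charCM χ) (Or.inr ⟨rfl, χ, rfl⟩))
      · exact map_zero M
      · intro f g _ _ hf hg
        rw [show ((0, f + g) : (Fin N → ℂ) × C(X, ℂ)) = (0, f) + (0, g) by simp, map_add, hf, hg,
          add_zero]
      · intro c f _ hf
        rw [show ((0, c • f) : (Fin N → ℂ) × C(X, ℂ)) = c • (0, f) by simp, map_smul, hf,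
          smul_zero]
    exact congrFun (Continuous.ext_on (dense_span_charCM m) hcont continuous_const hz) f
  have h1 : M (e i) = 0 := by
    rw [show e i = ((e i).1, 0) + (0, (e i).2) by simp, map_add, hM, add_zero]
    exact sub_eq_zero.2 (hP _ (Or.inl rfl))
  have h2 := sub_eq_zero.1 h1
  rwa [← hrow, ← hcst, Function.update_eq_self] at h2

end DetIntegral

/-! ### The pointwise rank bound, and covers adapted to finitely many characters. -/

/-- A matrix product `c * E` of size `N` is singular if at most `N` rows of `E` are nonzero and the
rows of `E` sum to zero. -/
theorem det_sum_mul_eq_zero {ι : Type*} [Fintype ι] {N : ℕ} (A : Finset ι)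
    (hA : A.card ≤ N) (hne : A.Nonempty) (E : ι → Fin N → ℂ) (hE : ∀ v ∉ A, E v = 0)
    (hsum : ∑ v, E v = 0) (c : Fin N → ι → ℂ) :
    (Matrix.of fun i j => ∑ v, c i v * E v j).det = 0 := by
  classical
  obtain ⟨v0, hv0⟩ := hne
  -- Only the active indices other than v0 are imposed, at most N - 1 conditions, so a nonzero
  -- solution exists; the condition at v0 then follows from the zero sum.
  let L : (Fin N → ℂ) →ₗ[ℂ] (A.erase v0 → ℂ) :=
    LinearMap.pi fun v => ∑ j, E v j • LinearMap.proj j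
  have hker : LinearMap.ker L ≠ ⊥ := by
    refine LinearMap.ker_ne_bot_of_finrank_lt ?_
    have h1 := Finset.card_erase_lt_of_mem hv0
    simp only [Module.finrank_fintype_fun_eq_card, Fintype.card_coe, Fintype.card_fin]
    omega
  obtain ⟨u, hu, hu0⟩ := Submodule.exists_mem_ne_zero_of_ne_bot hker
  have h1 : ∀ v ≠ v0, ∑ j, E v j * u j = 0 := fun v hv => by
    by_cases hvA : v ∈ A
    · have h2 := congrFun (LinearMap.mem_ker.1 hu) ⟨v, Finset.mem_erase.2 ⟨hv, hvA⟩⟩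
      simpa [L] using h2
    · simp [hE v hvA]
  have h2 : ∀ v, ∑ j, E v j * u j = 0 := fun v => by
    rcases eq_or_ne v v0 with rfl | hv
    · have h3 : ∑ v', ∑ j, E v' j * u j = 0 := by
        rw [Finset.sum_comm]
        refine Finset.sum_eq_zero fun j _ => ?_
        rw [← Finset.sum_mul]
        have h4 := congrFun hsum j
        rw [Finset.sum_apply] at h4
        rw [h4, Pi.zero_apply, zero_mul]
      rwa [Finset.sum_eq_single v (fun w _ hw => h1 w hw) (by simp)] at h3
    · exact h1 v hv
  refine Matrix.exists_mulVec_eq_zero_iff.1 ⟨u, hu0, ?_⟩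
  ext i
  simp only [Matrix.mulVec, dotProduct, Matrix.of_apply, Finset.sum_mul, Pi.zero_apply]
  rw [Finset.sum_comm]
  refine Finset.sum_eq_zero fun v _ => ?_
  simp only [mul_assoc, ← Finset.mul_sum]
  rw [h2, mul_zero]

section Covering

variable {X : Type*} [CommGroup X] [TopologicalSpace X] [IsTopologicalGroup X] [CompactSpace X]
  [T2Space X] {N d : ℕ}

/-- On each member V every χ_i stays within a quarter turn of its value at a base point of V, so the
principal argument is a continuous local logarithm there. -/
theorem exists_fine_cover (hd : CoveringDimLE X d) (χ : Fin N → (X →ₜ* Circle)) :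
    ∃ (𝒱 : Set (Set X)) (p : Set X → X), 𝒱.Finite ∧ (∀ V ∈ 𝒱, IsOpen V) ∧ ⋃₀ 𝒱 = Set.univ ∧
      (∀ V ∈ 𝒱, ∀ x ∈ V, ∀ i, 0 < ((χ i (p V) * (χ i x)⁻¹ : Circle) : ℂ).re) ∧
      ∀ x : X, {V | V ∈ 𝒱 ∧ x ∈ V}.encard ≤ (d : ℕ∞) + 1 := by
  let U : X → Set X := fun p => {x | ∀ i, 0 < ((χ i p * (χ i x)⁻¹ : Circle) : ℂ).re}
  have hUo : ∀ p, IsOpen (U p) := fun p => by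
    simp only [U, Set.setOf_forall]
    refine isOpen_iInter_of_finite fun i => isOpen_lt continuous_const ?_
    fun_prop
  have hUp : ∀ p, p ∈ U p := fun p i => by simp
  obtain ⟨F, hF⟩ := isCompact_univ.elim_finite_subcover U hUo
    fun p _ => Set.mem_iUnion.2 ⟨p, hUp p⟩
  obtain ⟨𝒱, h1, h2, h3, h4, h5⟩ := hd (U '' F) (F.finite_toSet.image U)
    (by rintro _ ⟨p, -, rfl⟩; exact hUo p)
    (by rw [Set.sUnion_image]; exact Set.univ_subset_iff.1 hF)
  have h6 : ∀ V, ∃ p, V ∈ 𝒱 → V ⊆ U p := fun V => by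
    by_cases hV : V ∈ 𝒱
    · obtain ⟨_, ⟨p, -, rfl⟩, hVp⟩ := h4 V hV
      exact ⟨p, fun _ => hVp⟩
    · exact ⟨1, fun h => absurd h hV⟩
  choose p hp using h6
  exact ⟨𝒱, p, h1, h2, h3, fun V hV x hx => hp V hV hx, h5⟩

open scoped Pointwise in
/-- Uniform version of the fact that a support in an open set is preserved by small translations. -/
theorem exists_pos_forall_mul_mem {ι : Type*} [Finite ι] {σ : (Fin N → ℝ) → X}
    (hσ : Continuous σ) (hσadd : ∀ u v, σ (u + v) = σ u * σ v) (K V : ι → Set X)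
    (hK : ∀ v, IsClosed (K v)) (hV : ∀ v, IsOpen (V v)) (hKV : ∀ v, K v ⊆ V v) :
    ∃ δ : ℝ, 0 < δ ∧ δ ≤ 1 ∧ ∀ v x (t : Fin N → ℝ), (∀ k, t k ∈ Set.Icc (0 : ℝ) 1) →
      x * σ (δ • t) ∈ K v → x ∈ V v := by
  have hσ0 : σ 0 = 1 := by simpa using hσadd 0 0
  have hW : ∀ v, ∃ W ∈ 𝓝 (1 : X), K v * W ⊆ V v := fun v =>
    compact_open_separated_mul_right (hK v).isCompact (hV v) (hKV v)
  choose W hW1 hW2 using hW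
  -- The sign is there because x is recovered from x * σ u on multiplying by σ (-u).
  have hmem : {u : Fin N → ℝ | ∀ v, σ (-u) ∈ W v} ∈ 𝓝 0 := by
    refine eventually_all.2 fun v => ?_
    have h1 : Tendsto (fun u : Fin N → ℝ => σ (-u)) (𝓝 0) (𝓝 1) := by
      have := (hσ.comp continuous_neg).tendsto (0 : Fin N → ℝ)
      simpa [hσ0, Function.comp_def] using this
    exact h1 (hW1 v)
  obtain ⟨ε, hε, hball⟩ := Metric.mem_nhds_iff.1 hmem
  refine ⟨min (ε / 2) 1, by positivity, min_le_right _ _, fun v x t ht hx => ?_⟩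
  set δ := min (ε / 2) 1
  have hδ : 0 < δ := by positivity
  have h1 : δ • t ∈ Metric.ball (0 : Fin N → ℝ) ε := by
    rw [mem_ball_zero_iff, norm_smul, Real.norm_of_nonneg hδ.le]
    have h2 : ‖t‖ ≤ 1 := (pi_norm_le_iff_of_nonneg zero_le_one).2 fun k => by
      rw [Real.norm_of_nonneg (ht k).1]
      exact (ht k).2
    have h3 : δ ≤ ε / 2 := min_le_left _ _
    nlinarith
  have h4 := hW2 v (Set.mul_mem_mul hx (hball h1 v))
  rwa [mul_assoc, ← hσadd, add_neg_cancel, hσ0, mul_one] at h4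

end Covering

/-- The argument starts within π/2 of 0 and moves by at most 1 < π/2, so it never meets the branch
cut. This is why δ ≤ 1 is demanded below. -/
theorem arg_mul_exp_neg {z : Circle} (hz : 0 < (z : ℂ).re) {s : ℝ} (hs0 : 0 ≤ s) (hs1 : s ≤ 1) :
    Complex.arg ((z * Circle.exp (-s) : Circle) : ℂ) = Complex.arg (z : ℂ) - s := by
  have h1 := abs_lt.1 (Complex.abs_arg_lt_pi_div_two_iff.2 (Or.inl hz))
  have h2 := Real.pi_gt_three
  conv_lhs => rw [← Circle.exp_arg z, ← Circle.exp_add, ← sub_eq_add_neg]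
  exact Circle.arg_exp (by linarith) (by linarith)

/-! ### The rank of the dual is bounded by the covering dimension. -/

section Dimension

variable {X : Type*} [CommGroup X] [TopologicalSpace X] [IsTopologicalGroup X] [CompactSpace X]
  [T2Space X] {N : ℕ} {ι : Type*} [Fintype ι]

theorem update_mem_Icc {t : Fin N → ℝ} (ht : ∀ k, t k ∈ Set.Icc (0 : ℝ) 1) {j : Fin N} {s : ℝ}
    (hs : s ∈ Set.Icc (0 : ℝ) 1) (k : Fin N) : Function.update t j s k ∈ Set.Icc (0 : ℝ) 1 := by
  rcases eq_or_ne k j with rfl | hk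
  · simpa using hs
  · rw [Function.update_of_ne hk]
    exact ht k

theorem gridDeriv_apply_eq_zero (σ : C(Fin N → ℝ, X)) {δ : ℝ} {j : Fin N} {f : C(X, ℂ)} {x : X}
    (h : ∀ t : Fin N → ℝ, (∀ k, t k ∈ Set.Icc (0 : ℝ) 1) → f (x * σ (δ • t)) = 0) :
    gridDeriv σ δ j f x = 0 := by
  rw [gridDeriv_apply, integral_eq_zero_of_ae, mul_zero]
  refine (ae_cubeMeasure_mem N).mono fun t ht => ?_
  dsimp only
  rw [h _ (update_mem_Icc ht (by simp)), h _ (update_mem_Icc ht (by simp)), sub_zero,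
    Pi.zero_apply]

theorem continuous_mul_arg {ρ : C(X, ℝ)} {V : Set X} {χ : X →ₜ* Circle} {p : X}
    (hρ : tsupport ρ ⊆ V) (hV : ∀ x ∈ V, 0 < ((χ p * (χ x)⁻¹ : Circle) : ℂ).re) :
    Continuous fun x => ρ x * Complex.arg ((χ p * (χ x)⁻¹ : Circle) : ℂ) := by
  refine continuous_of_tsupport fun x hx => ρ.continuous.continuousAt.mul ?_
  have hxV : x ∈ V := hρ (tsupport_mul_subset_left hx)
  have h1 : Continuous fun x => ((χ p * (χ x)⁻¹ : Circle) : ℂ) := by fun_prop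
  exact ContinuousAt.comp (f := fun x => ((χ p * (χ x)⁻¹ : Circle) : ℂ)) (g := Complex.arg)
    (Complex.continuousAt_arg (Or.inl (hV x hxV))) h1.continuousAt

/-- The averaged partial derivatives of the local logarithms `∑ ρ v * arg (χ (p v) / χ)`. -/
theorem gridDeriv_sum_mul_arg (σ : C(Fin N → ℝ, X)) {δ : ℝ} (hδ0 : 0 < δ) (hδ1 : δ ≤ 1)
    (ρ : ι → C(X, ℝ)) (V : ι → Set X) (p : ι → X) (χ : X →ₜ* Circle) (i : Fin N)
    (hχσ : ∀ u, χ (σ u) = Circle.exp (u i))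
    (hρ1 : ∀ x, ∑ v, ρ v x = 1)
    (hV : ∀ v, ∀ x ∈ V v, 0 < ((χ (p v) * (χ x)⁻¹ : Circle) : ℂ).re)
    (hδ : ∀ v x (t : Fin N → ℝ), (∀ k, t k ∈ Set.Icc (0 : ℝ) 1) → ρ v (x * σ (δ • t)) ≠ 0 →
      x ∈ V v)
    (ρC : ι → C(X, ℂ)) (hρC : ∀ v x, ρC v x = ρ v x)
    (h : C(X, ℂ))
    (hh : ∀ x, h x = ((∑ v, ρ v x * Complex.arg ((χ (p v) * (χ x)⁻¹ : Circle) : ℂ) : ℝ) : ℂ))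
    (j : Fin N) (x : X) :
    gridDeriv σ δ j h x = ∑ v, (Complex.arg ((χ (p v) * (χ x)⁻¹ : Circle) : ℂ) : ℂ) *
      gridDeriv σ δ j (ρC v) x - (if i = j then 1 else 0) := by
  set c : ι → ℝ := fun v => Complex.arg ((χ (p v) * (χ x)⁻¹ : Circle) : ℂ) with hc
  -- Moving along σ lowers every active logarithm by the same δ * t i, and the weights sum to 1.
  -- Thus on the cube h is a combination of the ρ_v with coefficients frozen at x, minus a linear
  -- coordinate.
  have h1 : ∀ t : Fin N → ℝ, (∀ k, t k ∈ Set.Icc (0 : ℝ) 1) → h (x * σ (δ • t)) =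
      ∑ v, (c v : ℂ) * ρC v (x * σ (δ • t)) - δ * t i := fun t ht => by
    have h2 : ∀ v, ρ v (x * σ (δ • t)) *
        Complex.arg ((χ (p v) * (χ (x * σ (δ • t)))⁻¹ : Circle) : ℂ) =
        ρ v (x * σ (δ • t)) * (c v - δ * t i) := fun v => by
      by_cases h0 : ρ v (x * σ (δ • t)) = 0
      · simp [h0]
      · have h3 := hV v x (hδ v x t ht h0)
        have h6 : χ (p v) * (χ (x * σ (δ • t)))⁻¹ =
            χ (p v) * (χ x)⁻¹ * Circle.exp (-(δ * t i)) := by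
          rw [map_mul χ x, mul_inv, ← mul_assoc, hχσ, ← Circle.exp_neg, Pi.smul_apply, smul_eq_mul]
        rw [h6, arg_mul_exp_neg h3 (mul_nonneg hδ0.le (ht i).1)
            (mul_le_one₀ hδ1 (ht i).1 (ht i).2)]
    rw [hh, Finset.sum_congr rfl fun v _ => h2 v]
    simp only [mul_sub, Finset.sum_sub_distrib, ← Finset.sum_mul, hρ1, one_mul]
    push_cast
    simp only [hρC, mul_comm]
  have hcont : ∀ (v : ι) (s : ℝ), Continuous fun t : Fin N → ℝ =>
      ρC v (x * σ (δ • Function.update t j s)) := fun v s => by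
    refine (ρC v).continuous.comp (continuous_const.mul (σ.continuous.comp ?_))
    exact (continuous_id.update j continuous_const).const_smul δ
  have h4 : ∫ t, (h (x * σ (δ • Function.update t j 1)) - h (x * σ (δ • Function.update t j 0)))
      ∂cubeMeasure N = ∫ t, (∑ v, (c v : ℂ) * (ρC v (x * σ (δ • Function.update t j 1)) -
        ρC v (x * σ (δ • Function.update t j 0))) - δ * (if i = j then 1 else 0))
        ∂cubeMeasure N := by
    refine integral_congr_ae ((ae_cubeMeasure_mem N).mono fun t ht => ?_)
    dsimp only
    rw [h1 _ (update_mem_Icc ht (by simp)), h1 _ (update_mem_Icc ht (by simp))]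
    simp only [mul_sub, Finset.sum_sub_distrib]
    by_cases hij : i = j
    · subst hij
      simp
      ring
    · simp [hij]
  have hδ' : (δ : ℂ) ≠ 0 := by exact_mod_cast hδ0.ne'
  have hint : ∀ v, Integrable (fun t : Fin N → ℝ => (c v : ℂ) *
      (ρC v (x * σ (δ • Function.update t j 1)) - ρC v (x * σ (δ • Function.update t j 0))))
      (cubeMeasure N) := fun v =>
    integrable_cubeMeasure (((hcont v 1).sub (hcont v 0)).const_mul _)
  rw [gridDeriv_apply, h4, integral_sub (integrable_finset_sum _ fun v _ => hint v)
    (integrable_const _), integral_finset_sum _ fun v _ => hint v]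
  simp only [integral_const_mul, gridDeriv_apply, integral_const, probReal_univ, one_smul]
  rw [mul_sub, inv_mul_cancel_left₀ hδ', Finset.mul_sum]
  congr 1
  exact Finset.sum_congr rfl fun v _ => mul_left_comm _ _ _

/-- A compact abelian group of covering dimension at most `d` has no `d + 1` independent
characters. -/
theorem not_linearIndependent_of_coveringDimLE [MeasurableSpace X] [BorelSpace X] (m : Measure X)
    [IsProbabilityMeasure m] [m.IsHaarMeasure] {d : ℕ} (hd : CoveringDimLE X d)
    (χ : Fin (d + 1) → Additive (X →ₜ* Circle)) : ¬ LinearIndependent ℤ χ := by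
  classical
  intro hχ
  obtain ⟨ℓ, hℓ⟩ := exists_addMonoidHom_eq_single hχ
  obtain ⟨σ, hσc, hσ, hσadd⟩ := exists_hom_of_dual m ℓ
  obtain ⟨𝒱, p, hfin, hopen, hcover, hre, hcard⟩ := exists_fine_cover hd fun i => (χ i).toMul
  have : Fintype 𝒱 := hfin.fintype
  obtain ⟨ρ, hρ⟩ := PartitionOfUnity.exists_isSubordinate_of_locallyFinite isClosed_univ
    (fun V : 𝒱 => (V : Set X)) (fun V => hopen V V.2) (locallyFinite_of_finite _)
    (by rw [← Set.sUnion_eq_iUnion, hcover])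
  obtain ⟨δ, hδ0, hδ1, hδ⟩ := exists_pos_forall_mul_mem hσc hσadd (fun V => tsupport (ρ V))
    (fun V : 𝒱 => (V : Set X)) (fun V => isClosed_tsupport _) (fun V => hopen V V.2) hρ
  have hδ' : ∀ (V : 𝒱) x (t : Fin (d + 1) → ℝ), (∀ k, t k ∈ Set.Icc (0 : ℝ) 1) →
      ρ V (x * σ (δ • t)) ≠ 0 → x ∈ (V : Set X) := fun V x t ht h0 =>
    hδ V x t ht (subset_tsupport _ h0)
  have hρ1 : ∀ x, ∑ V, ρ V x = 1 := fun x => by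
    rw [← finsum_eq_sum_of_fintype]
    exact ρ.sum_eq_one (Set.mem_univ x)
  let σC : C(Fin (d + 1) → ℝ, X) := ⟨σ, hσc⟩
  let ρC : 𝒱 → C(X, ℂ) := fun V => ⟨fun x => (ρ V x : ℂ), by fun_prop⟩
  let D := gridDeriv σC δ
  have hexp : ∀ i u, (χ i).toMul (σ u) = Circle.exp (u i) := fun i u => by
    rw [hσ, ofMul_toMul, hℓ, Finset.sum_eq_single i (by intros; simp_all) (by simp)]
    simp
  have hcont : ∀ i, Continuous fun x => ∑ V, ρ V x *
      Complex.arg (((χ i).toMul (p V) * ((χ i).toMul x)⁻¹ : Circle) : ℂ) := fun i =>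
    continuous_finset_sum _ fun V _ => continuous_mul_arg (hρ V) fun x hx => hre V V.2 x hx i
  let h : Fin (d + 1) → C(X, ℂ) := fun i => ⟨fun x => ((∑ V, ρ V x *
      Complex.arg (((χ i).toMul (p V) * ((χ i).toMul x)⁻¹ : Circle) : ℂ) : ℝ) : ℂ),
    Complex.continuous_ofReal.comp (hcont i)⟩
  have hDh : ∀ i j x, D j (h i) x = ∑ V : 𝒱,
      (Complex.arg (((χ i).toMul (p V) * ((χ i).toMul x)⁻¹ : Circle) : ℂ) : ℂ) *
        D j (ρC V) x - (if i = j then 1 else 0) := fun i j x =>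
    gridDeriv_sum_mul_arg σC hδ0 hδ1 (fun V => ρ V) (fun V => (V : Set X)) (fun V => p V)
      (χ i).toMul i (hexp i) hρ1 (fun V x hx => hre V V.2 x hx i) hδ' ρC (fun _ _ => rfl) (h i)
      (fun _ => rfl) j x
  have hκ : ∀ ψ : X →ₜ* Circle, ∃ κ : ℂ, ∀ j,
      D j (charCM ψ) = (κ * (ℓ (Additive.ofMul ψ) j : ℂ)) • charCM ψ := fun ψ =>
    exists_gridDeriv_charCM_eq σC δ hσ hδ0.ne' ψ
  choose κ hκ using hκ
  -- The constant part is the identity matrix, so the integral of the determinant is 1; the sign -1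
  -- in `hDh` cancels exactly this constant part.
  have key := integralCM_det_derivMatrix (D := D)
    (w := fun ψ j => (ℓ (Additive.ofMul ψ) j : ℂ)) m (fun ψ ψ' => by ext j; simp) κ hκ
    fun i => (Pi.single i 1, h i)
  have hone : (Matrix.of fun i : Fin (d + 1) => (Pi.single i 1 : Fin (d + 1) → ℂ)) = 1 := by
    ext i j
    simp [Matrix.one_apply, Pi.single_apply, eq_comm]
  have hzero : (derivMatrix D fun i => (Pi.single i 1, h i)).det = 0 := by
    ext x
    have h1 : (derivMatrix D fun i => (Pi.single i 1, h i)).det x =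
        ((derivMatrix D fun i => (Pi.single i 1, h i)).map fun f => f x).det :=
      RingHom.map_det (⟨⟨⟨fun f : C(X, ℂ) => f x, rfl⟩, fun _ _ => rfl⟩, rfl, fun _ _ => rfl⟩ :
        C(X, ℂ) →+* ℂ) _
    have h2 : ((derivMatrix D fun i => (Pi.single i 1, h i)).map fun f => f x) =
        Matrix.of fun i j => ∑ V : 𝒱,
          (Complex.arg (((χ i).toMul (p V) * ((χ i).toMul x)⁻¹ : Circle) : ℂ) : ℂ) *
            D j (ρC V) x := by
      ext i j
      have h3 := hDh i j x
      rcases eq_or_ne i j with rfl | hij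
      · simp [derivMatrix, h3]
      · simp [derivMatrix, h3, hij]
    rw [h1, h2, ContinuousMap.zero_apply]
    obtain ⟨V0, hV0, hxV0⟩ : ∃ V ∈ 𝒱, x ∈ V := by
      have : x ∈ ⋃₀ 𝒱 := hcover ▸ Set.mem_univ x
      simpa using this
    refine det_sum_mul_eq_zero (Finset.univ.filter fun V : 𝒱 => x ∈ (V : Set X)) ?_
      ⟨⟨V0, hV0⟩, by simpa using hxV0⟩ (fun V j => D j (ρC V) x) (fun V hV => ?_) ?_
      (fun i V => (Complex.arg (((χ i).toMul (p V) * ((χ i).toMul x)⁻¹ : Circle) : ℂ) : ℂ))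
    · have h3 := hcard x
      have h4 : {V | V ∈ 𝒱 ∧ x ∈ V} = ((Finset.univ.filter fun V : 𝒱 => x ∈ (V : Set X)).map
          (Function.Embedding.subtype _) : Finset (Set X)) := by
        ext V
        simp [and_comm]
      rw [h4, Set.encard_coe_eq_coe_finsetCard, Finset.card_map] at h3
      exact_mod_cast h3
    · ext j
      have hx : x ∉ (V : Set X) := by simpa using hV
      refine gridDeriv_apply_eq_zero σC fun t ht => ?_
      by_contra h0
      exact hx (hδ' V x t ht fun h5 => h0 (by simp [ρC, σC, h5]))
    · ext j
      -- The partition of unity sums to the trivial character, whose D_j-eigenvalue is 0.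
      have h3 : ∑ V, ρC V = charCM 1 := by
        ext y
        have := hρ1 y
        simp [ρC]
        exact_mod_cast this
      rw [Finset.sum_apply, Pi.zero_apply]
      have h4 := congrArg (fun f => D j f x) h3
      have h5 : D j (charCM 1) x = 0 := by rw [hκ]; simp
      rw [h5] at h4
      simpa using h4
  rw [hzero, map_zero, hone, Matrix.det_one] at key
  exact zero_ne_one key

end Dimension

/-! ### A p-adic Strassmann theorem for binomial series. -/

section Strassmann

variable {p : ℕ} [Fact p.Prime]

-- Dividing by X - t shifts a bound on the tail of coefficients down by one index: Q_j = P_{j+1} + t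
-- Q_{j+1}, iterated downwards from the degree.
open Polynomial in
theorem norm_coeff_le_of_X_sub_C_mul {Q : ℚ_[p][X]} {t : ℚ_[p]} (ht : ‖t‖ ≤ 1) {c : ℝ}
    (hc : 0 ≤ c) {k : ℕ} (h : ∀ j, k + 1 ≤ j → ‖((X - C t) * Q).coeff j‖ ≤ c) (j : ℕ)
    (hj : k ≤ j) : ‖Q.coeff j‖ ≤ c := by
  suffices H : ∀ n j, k ≤ j → Q.natDegree < j + n → ‖Q.coeff j‖ ≤ c from
    H (Q.natDegree + 1) j hj (by omega)
  intro n
  induction n with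
  | zero =>
    intro j _ hd
    rwa [coeff_eq_zero_of_natDegree_lt (by simpa using hd), norm_zero]
  | succ n ih =>
    intro j hj hd
    have h1 : Q.coeff j = ((X - Polynomial.C t) * Q).coeff (j + 1) + t * Q.coeff (j + 1) := by
      simp [sub_mul]
    rw [h1]
    refine (IsUltrametricDist.norm_add_le_max _ _).trans (max_le (h (j + 1) (by omega)) ?_)
    rw [norm_mul]
    exact (mul_le_of_le_one_left (norm_nonneg _) ht).trans (ih _ (by omega) (by omega))

open Polynomial in
theorem norm_eval_natCast_le {Q : ℚ_[p][X]} {C : ℝ} (hC : 0 ≤ C) (h : ∀ j, ‖Q.coeff j‖ ≤ C)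
    (t : ℕ) : ‖Q.eval (t : ℚ_[p])‖ ≤ C := by
  rw [eval_eq_sum_range]
  refine IsUltrametricDist.norm_sum_le_of_forall_le_of_nonneg hC fun j _ => ?_
  rw [norm_mul, norm_pow]
  have h1 : ‖(t : ℚ_[p])‖ ≤ 1 := by exact_mod_cast Padic.norm_int_le_one (p := p) t
  exact (mul_le_of_le_one_right (norm_nonneg _) (pow_le_one₀ (norm_nonneg _) h1)).trans (h j)

open Polynomial in
/-- If a `p`-adic polynomial has `k` natural zeros, its values at natural numbers are bounded by
the norms of its coefficients of index at least `k`. -/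
theorem norm_eval_natCast_le_of_card_zeros {C : ℝ} (hC : 0 ≤ C) (S : Finset ℕ) :
    ∀ P : ℚ_[p][X], (∀ a ∈ S, P.eval (a : ℚ_[p]) = 0) → (∀ j, S.card ≤ j → ‖P.coeff j‖ ≤ C) →
      ∀ t : ℕ, ‖P.eval (t : ℚ_[p])‖ ≤ C := by
  induction S using Finset.induction_on with
  | empty => exact fun P _ h t => norm_eval_natCast_le hC (fun j => h j (by simp)) t
  | insert a S ha ih =>
    intro P h0 h t
    have hcast : ∀ n : ℕ, ‖(n : ℚ_[p])‖ ≤ 1 := fun n => by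
      exact_mod_cast Padic.norm_int_le_one (p := p) n
    obtain ⟨Q, rfl⟩ := dvd_iff_isRoot.2 (h0 a (Finset.mem_insert_self a S))
    rw [Finset.card_insert_of_notMem ha] at h
    have h1 := ih Q (fun b hb => ?_) (norm_coeff_le_of_X_sub_C_mul (hcast a) hC h) t
    · have h2 : ‖(t : ℚ_[p]) - a‖ ≤ 1 := by
        exact_mod_cast Padic.norm_int_le_one (p := p) (t - a)
      rw [eval_mul, norm_mul]
      simp only [eval_sub, eval_X, eval_C]
      exact (mul_le_of_le_one_left (norm_nonneg _) h2).trans h1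
    · have h3 := h0 b (Finset.mem_insert_of_mem hb)
      rw [eval_mul, mul_eq_zero] at h3
      refine h3.resolve_left ?_
      simp only [eval_sub, eval_X, eval_C, sub_eq_zero, Nat.cast_inj]
      exact ne_of_mem_of_not_mem hb ha

/-- Legendre's formula gives v_p(j!) ≤ j / (p - 1) ≤ j / 2. For p = 2 there would be no decay,
whence the odd prime. -/
theorem norm_pow_div_factorial_le (hp : 3 ≤ p) (j : ℕ) :
    ‖(p : ℚ_[p]) ^ j / (j.factorial : ℚ_[p])‖ ≤ √((p : ℝ)⁻¹) ^ j := by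
  have hp0 : (0 : ℝ) < p := by exact_mod_cast (Fact.out : p.Prime).pos
  have hval : 2 * padicValNat p j.factorial ≤ j := by
    have h1 := sub_one_mul_padicValNat_factorial (p := p) j
    have h2 : 2 * padicValNat p j.factorial ≤ (p - 1) * padicValNat p j.factorial :=
      Nat.mul_le_mul_right _ (by omega)
    omega
  have hfac : ‖(j.factorial : ℚ_[p])‖ = ((p : ℝ) ^ padicValNat p j.factorial)⁻¹ := by
    rw [Padic.norm_eq_zpow_neg_valuation (by exact_mod_cast j.factorial_ne_zero),
      Padic.valuation_natCast, zpow_neg, zpow_natCast]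
  set r : ℝ := √((p : ℝ)⁻¹) with hr
  have hr0 : 0 < r := Real.sqrt_pos.2 (by positivity)
  have hr2 : r ^ 2 = (p : ℝ)⁻¹ := Real.sq_sqrt (by positivity)
  have hr1 : r ≤ 1 := by
    rw [hr, Real.sqrt_le_one]
    exact inv_le_one_of_one_le₀ (by exact_mod_cast (Fact.out : p.Prime).one_le)
  rw [norm_div, norm_pow, Padic.norm_p, hfac, ← inv_pow, ← hr2, ← pow_mul, ← pow_mul,
    div_eq_mul_inv, ← pow_sub₀ _ hr0.ne' (by omega)]
  exact pow_le_pow_of_le_one hr0.le hr1 (by omega)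

open Polynomial in
/-- A Mahler series whose coefficients are divisible by increasing powers of an odd prime `p`
vanishes identically as soon as it has infinitely many zeros. -/
theorem sum_choose_mul_pow_eq_zero (hp : 3 ≤ p) {b : ℕ → ℚ_[p]} {K : ℝ} (hb : ∀ j, ‖b j‖ ≤ K)
    (hinf : {q : ℕ | ∑ j ∈ Finset.range (q + 1), (q.choose j : ℚ_[p]) * p ^ j * b j = 0}.Infinite)
    (t : ℕ) : ∑ j ∈ Finset.range (t + 1), (t.choose j : ℚ_[p]) * p ^ j * b j = 0 := by
  set f : ℕ → ℚ_[p] := fun q =>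
    ∑ j ∈ Finset.range (q + 1), (q.choose j : ℚ_[p]) * p ^ j * b j with hf
  have hK : 0 ≤ K := (norm_nonneg _).trans (hb 0)
  set r : ℝ := √((p : ℝ)⁻¹) with hr
  have hr0 : 0 ≤ r := Real.sqrt_nonneg _
  have hp1 : (1 : ℝ) < p := by exact_mod_cast (Fact.out : p.Prime).one_lt
  have hr1 : r < 1 := by
    rw [hr, Real.sqrt_lt' one_pos, one_pow]
    exact inv_lt_one_of_one_lt₀ hp1
  -- Polynomial truncation of the series, exact at all naturals up to n. Its i-th coefficient only
  -- involves j ≥ i, hence decays like r ^ i uniformly in n.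
  let R : ℕ → ℚ_[p][X] := fun n => ∑ j ∈ Finset.range (n + 1),
    C (b j * ((p : ℚ_[p]) ^ j / (j.factorial : ℚ_[p]))) * descPochhammer ℚ_[p] j
  have hReval : ∀ n q, q ≤ n → (R n).eval (q : ℚ_[p]) = f q := fun n q hqn => by
    simp only [R, eval_finset_sum, eval_mul, eval_C, descPochhammer_eval_eq_descFactorial, hf]
    rw [← Finset.sum_subset (Finset.range_mono (Nat.succ_le_succ hqn))]
    · refine Finset.sum_congr rfl fun j _ => ?_
      have h1 : (j.factorial : ℚ_[p]) ≠ 0 := by exact_mod_cast j.factorial_ne_zero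
      rw [Nat.descFactorial_eq_factorial_mul_choose]
      push_cast
      field_simp
    · intro j _ hj
      rw [Nat.descFactorial_eq_zero_iff_lt.2 (by simpa using hj), Nat.cast_zero, mul_zero]
  have hRcoeff : ∀ n k i, k ≤ i → ‖(R n).coeff i‖ ≤ K * r ^ k := fun n k i hki => by
    simp only [R, finset_sum_coeff, coeff_C_mul]
    refine IsUltrametricDist.norm_sum_le_of_forall_le_of_nonneg (by positivity) fun j _ => ?_
    rcases lt_or_ge j i with hji | hij
    · rw [coeff_eq_zero_of_natDegree_lt (by rwa [descPochhammer_natDegree]), mul_zero, norm_zero]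
      positivity
    · have h1 : ‖(descPochhammer ℚ_[p] j).coeff i‖ ≤ 1 := by
        rw [← descPochhammer_map (Int.castRingHom ℚ_[p]), coeff_map]
        exact Padic.norm_int_le_one _
      rw [norm_mul, norm_mul]
      calc _ ≤ K * r ^ j * 1 := by
            gcongr
            · exact hb j
            · exact norm_pow_div_factorial_le hp j
        _ ≤ _ := by
            rw [mul_one]
            gcongr K * ?_
            exact pow_le_pow_of_le_one hr0 hr1.le (hki.trans hij)
  -- The truncation order exceeds t and k chosen zeros; removing these zeros leaves only
  -- coefficients of index at least k.
  have hle : ∀ k : ℕ, ‖f t‖ ≤ K * r ^ k := fun k => by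
    obtain ⟨S, hS, hSk⟩ := hinf.exists_subset_card_eq k
    have h1 := norm_eval_natCast_le_of_card_zeros (C := K * r ^ k) (by positivity) S
      (R (S.sup id + t)) (fun a ha => ?_) (fun j hj => hRcoeff _ k j (hSk ▸ hj)) t
    · rwa [hReval _ _ (by omega)] at h1
    · rw [hReval _ _ ((show a ≤ S.sup id from Finset.le_sup (f := id) ha).trans (by omega))]
      exact hS ha
  have hlim : Tendsto (fun k : ℕ => K * r ^ k) atTop (𝓝 0) := by
    simpa using (tendsto_pow_atTop_nhds_zero_of_lt_one hr0 hr1).const_mul K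
  exact norm_le_zero_iff.1 (ge_of_tendsto' hlim hle)

/-- A sum of matrix-like power sequences, each congruent to one modulo an odd prime along the
period `l`, vanishes identically along residue classes as soon as it has infinitely many zeros. -/
theorem sum_apply_pow_eq_zero (hp : 3 ≤ p) {R : Type*} [Ring R] [Algebra ℤ_[p] R] {s : ℕ}
    (F : Fin s → R →ₗ[ℤ_[p]] ℚ_[p]) {K : Fin s → ℝ} (hF : ∀ i x, ‖F i x‖ ≤ K i)
    (M B : Fin s → R) {l : ℕ} (hM : ∀ i, M i ^ l = (p : ℤ_[p]) • B i + 1) (k : ℕ)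
    (hinf : {q : ℕ | ∑ i, F i (M i ^ (l * q + k)) = 0}.Infinite) (q : ℕ) :
    ∑ i, F i (M i ^ (l * q + k)) = 0 := by
  -- Binomial expansion of (1 + p B)^q; the coefficients are bounded because each F i is bounded.
  have h1 : ∀ q, ∑ i, F i (M i ^ (l * q + k)) = ∑ j ∈ Finset.range (q + 1),
      (q.choose j : ℚ_[p]) * p ^ j * ∑ i, F i (B i ^ j * M i ^ k) := fun q => by
    simp only [Finset.mul_sum]
    rw [Finset.sum_comm]
    refine Finset.sum_congr rfl fun i _ => ?_
    rw [pow_add, pow_mul, hM, (Commute.one_right _).add_pow, Finset.sum_mul, map_sum]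
    refine Finset.sum_congr rfl fun j _ => ?_
    have h2 : ((p : ℤ_[p]) • B i) ^ j * 1 ^ (q - j) * (q.choose j : R) * M i ^ k =
        ((q.choose j : ℤ_[p]) * (p : ℤ_[p]) ^ j) • (B i ^ j * M i ^ k) := by
      rw [one_pow, mul_one, smul_pow, ← nsmul_eq_mul', smul_mul_assoc, smul_mul_assoc,
        ← Nat.cast_smul_eq_nsmul ℤ_[p], smul_smul]
    rw [h2, map_smul, Algebra.smul_def]
    simp
  simp only [h1] at hinf ⊢
  exact sum_choose_mul_pow_eq_zero hp (K := ∑ i, K i)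
    (fun j => (norm_sum_le _ _).trans (Finset.sum_le_sum fun i _ => hF i _)) hinf q

end Strassmann

/-! ### Skolem–Mahler–Lech with a period independent of the vectors. -/

section Rational

/-- A rational matrix whose denominators are prime to `p` comes from a `p`-adically integral
matrix. -/
theorem exists_padicInt_matrix {p : ℕ} [Fact p.Prime] {d : ℕ} (M : Matrix (Fin d) (Fin d) ℚ)
    (h : ∀ i j, ¬ p ∣ (M i j).den) :
    ∃ N : Matrix (Fin d) (Fin d) ℤ_[p],
      N.map (algebraMap ℤ_[p] ℚ_[p]) = M.map (algebraMap ℚ ℚ_[p]) :=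
  ⟨fun i j => ⟨(M i j : ℚ_[p]), Padic.norm_rat_le_one (h i j)⟩, by ext i j; rfl⟩

/-- The reduction mod p lies in the finite group GL_d(𝔽_p), so Lagrange's theorem applies. -/
theorem exists_pow_eq_smul_add_one {p : ℕ} [Fact p.Prime] {d : ℕ}
    {N N' : Matrix (Fin d) (Fin d) ℤ_[p]} (h : N * N' = 1) {l : ℕ}
    (hl : Nat.card (Matrix (Fin d) (Fin d) (ZMod p))ˣ ∣ l) :
    ∃ B : Matrix (Fin d) (Fin d) ℤ_[p], N ^ l = (p : ℤ_[p]) • B + 1 := by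
  let φ : Matrix (Fin d) (Fin d) ℤ_[p] →+* Matrix (Fin d) (Fin d) (ZMod p) :=
    PadicInt.toZMod.mapMatrix
  have h' : N' * N = 1 := mul_eq_one_comm.1 h
  let u : (Matrix (Fin d) (Fin d) (ZMod p))ˣ :=
    ⟨φ N, φ N', by rw [← map_mul, h, map_one], by rw [← map_mul, h', map_one]⟩
  have h1 : φ (N ^ l - 1) = 0 := by
    obtain ⟨c, rfl⟩ := hl
    have h2 : u ^ Nat.card (Matrix (Fin d) (Fin d) (ZMod p))ˣ = 1 := pow_card_eq_one'
    have h3 : φ N ^ Nat.card (Matrix (Fin d) (Fin d) (ZMod p))ˣ = 1 := congrArg Units.val h2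
    rw [map_sub, map_pow, pow_mul, h3, one_pow, map_one, sub_self]
  have h2 : ∀ i j, ∃ b : ℤ_[p], (N ^ l - 1) i j = p * b := fun i j => by
    have h3 : PadicInt.toZMod ((N ^ l - 1) i j) = 0 := congrFun (congrFun h1 i) j
    rw [← RingHom.mem_ker, PadicInt.ker_toZMod, PadicInt.maximalIdeal_eq_span_p,
      Ideal.mem_span_singleton] at h3
    exact h3
  choose B hB using h2
  refine ⟨B, ?_⟩
  rw [← sub_eq_iff_eq_add]
  ext i j
  exact hB i j

/-- The Skolem–Mahler–Lech theorem for sums of powers of invertible rational matrices, with a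
period depending only on the matrices. -/
theorem exists_period_matrix {s d : ℕ} (M : Fin s → Matrix (Fin d) (Fin d) ℚ)
    (hM : ∀ i, IsUnit (M i).det) :
    ∃ l : ℕ, 1 ≤ l ∧ ∀ (k : ℕ) (v : Fin s → Fin d → ℚ),
      {q : ℕ | ∑ i, (M i ^ (l * q + k)).mulVec (v i) = 0}.Infinite →
        ∀ q, ∑ i, (M i ^ (l * q + k)).mulVec (v i) = 0 := by
  classical
  -- An odd prime larger than every denominator in the matrices and their inverses, so that all of
  -- them are p-integral.
  obtain ⟨p, hple, hp⟩ := Nat.exists_infinite_primes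
    (3 + ∑ i, ∑ a, ∑ b, ((M i a b).den + ((M i)⁻¹ a b).den))
  have := Fact.mk hp
  have hden : ∀ i a b, (M i a b).den + ((M i)⁻¹ a b).den < p := fun i a b => by
    have h1 : (M i a b).den + ((M i)⁻¹ a b).den ≤
        ∑ b, ((M i a b).den + ((M i)⁻¹ a b).den) :=
      Finset.single_le_sum (f := fun b => (M i a b).den + ((M i)⁻¹ a b).den)
        (fun _ _ => Nat.zero_le _) (Finset.mem_univ b)
    have h2 : ∑ b, ((M i a b).den + ((M i)⁻¹ a b).den) ≤
        ∑ a, ∑ b, ((M i a b).den + ((M i)⁻¹ a b).den) :=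
      Finset.single_le_sum (f := fun a => ∑ b, ((M i a b).den + ((M i)⁻¹ a b).den))
        (fun _ _ => Nat.zero_le _) (Finset.mem_univ a)
    have h3 : ∑ a, ∑ b, ((M i a b).den + ((M i)⁻¹ a b).den) ≤
        ∑ i, ∑ a, ∑ b, ((M i a b).den + ((M i)⁻¹ a b).den) :=
      Finset.single_le_sum (f := fun i => ∑ a, ∑ b, ((M i a b).den + ((M i)⁻¹ a b).den))
        (fun _ _ => Nat.zero_le _) (Finset.mem_univ i)
    omega
  have hN := fun i => exists_padicInt_matrix (p := p) (M i) fun a b =>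
    Nat.not_dvd_of_pos_of_lt (M i a b).den_pos (by have := hden i a b; omega)
  have hN' := fun i => exists_padicInt_matrix (p := p) (M i)⁻¹ fun a b =>
    Nat.not_dvd_of_pos_of_lt ((M i)⁻¹ a b).den_pos (by have := hden i a b; omega)
  choose N hN using hN
  choose N' hN' using hN'
  let toP : Matrix (Fin d) (Fin d) ℤ_[p] →+* Matrix (Fin d) (Fin d) ℚ_[p] :=
    (algebraMap ℤ_[p] ℚ_[p]).mapMatrix
  let ofQ : Matrix (Fin d) (Fin d) ℚ →+* Matrix (Fin d) (Fin d) ℚ_[p] :=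
    (algebraMap ℚ ℚ_[p]).mapMatrix
  have htoP : ∀ i, toP (N i) = ofQ (M i) := hN
  have htoP' : ∀ i, toP (N' i) = ofQ (M i)⁻¹ := hN'
  have hinj : Function.Injective toP := fun A B h => by
    ext a b
    exact Subtype.ext (congrFun (congrFun h a) b)
  have hNN' : ∀ i, N i * N' i = 1 := fun i => hinj (by
    rw [map_mul, htoP, htoP', ← map_mul, Matrix.mul_nonsing_inv _ (hM i), map_one, map_one])
  choose B hB using fun i => exists_pow_eq_smul_add_one (hNN' i) dvd_rfl
  refine ⟨Nat.card (Matrix (Fin d) (Fin d) (ZMod p))ˣ, Nat.card_pos, fun k v hinf q => ?_⟩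
  set l := Nat.card (Matrix (Fin d) (Fin d) (ZMod p))ˣ
  ext c
  -- The c-th coordinate of A v. The vectors need not be p-integral: only boundedness of F is used,
  -- so p and l do not depend on them.
  let F : Fin s → Matrix (Fin d) (Fin d) ℤ_[p] →ₗ[ℤ_[p]] ℚ_[p] := fun i =>
    { toFun := fun A => ∑ a, (A c a : ℚ_[p]) * (v i a : ℚ_[p])
      map_add' := fun A A' => by simp [add_mul, Finset.sum_add_distrib]
      map_smul' := fun r A => by
        simp [Finset.mul_sum, mul_assoc, Algebra.smul_def] }
  have hF : ∀ i A, ‖F i A‖ ≤ ∑ a, ‖(v i a : ℚ_[p])‖ := fun i A => by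
    change ‖∑ a, (A c a : ℚ_[p]) * (v i a : ℚ_[p])‖ ≤ _
    exact (norm_sum_le _ _).trans (Finset.sum_le_sum fun a _ => (norm_mul _ _).trans_le
      (mul_le_of_le_one_left (norm_nonneg _) (PadicInt.norm_le_one _)))
  have key : ∀ n : ℕ, ∑ i, F i (N i ^ n) =
      (((∑ i, (M i ^ n).mulVec (v i)) c : ℚ) : ℚ_[p]) := fun n => by
    rw [Finset.sum_apply, Rat.cast_sum]
    refine Finset.sum_congr rfl fun i _ => ?_
    have h1 : toP (N i ^ n) = ofQ (M i ^ n) := by rw [map_pow, htoP, map_pow]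
    have h2 : ∀ a, (((N i ^ n) c a : ℤ_[p]) : ℚ_[p]) = (((M i ^ n) c a : ℚ) : ℚ_[p]) := fun a =>
      congrFun (congrFun h1 c) a
    simp only [F, LinearMap.coe_mk, AddHom.coe_mk, h2, Matrix.mulVec, dotProduct]
    push_cast
    rfl
  have h3 := sum_apply_pow_eq_zero (by omega) F hF N B hB k (hinf.mono fun q hq => by
    rw [Set.mem_setOf_eq] at hq ⊢
    rw [key, hq]
    simp) q
  rw [key] at h3
  exact_mod_cast h3

/-- The Skolem–Mahler–Lech theorem for sums of orbits of injective endomorphisms of a finite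
dimensional rational vector space. -/
theorem exists_period_linearMap {V : Type*} [AddCommGroup V] [Module ℚ V] [FiniteDimensional ℚ V]
    {s : ℕ} (A : Fin s → V →ₗ[ℚ] V) (hA : ∀ i, Function.Injective (A i)) :
    ∃ l : ℕ, 1 ≤ l ∧ ∀ (k : ℕ) (v : Fin s → V),
      {q : ℕ | ∑ i, (A i ^ (l * q + k)) (v i) = 0}.Infinite →
        ∀ q, ∑ i, (A i ^ (l * q + k)) (v i) = 0 := by
  let b := Module.finBasis ℚ V
  have hdet : ∀ i, IsUnit (LinearMap.toMatrix b b (A i)).det := fun i => by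
    rw [LinearMap.det_toMatrix]
    exact LinearEquiv.isUnit_det' (LinearEquiv.ofInjectiveEndo (A i) (hA i))
  obtain ⟨l, hl, h⟩ := exists_period_matrix (fun i => LinearMap.toMatrix b b (A i)) hdet
  have key : ∀ (n : ℕ) (v : Fin s → V), ∑ i, (A i ^ n) (v i) = 0 ↔
      ∑ i, (LinearMap.toMatrix b b (A i) ^ n).mulVec (b.repr (v i)) = 0 := fun n v => by
    have h1 : ∀ i, (LinearMap.toMatrix b b (A i) ^ n).mulVec (b.repr (v i)) =
        b.equivFun ((A i ^ n) (v i)) := fun i => by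
      rw [LinearMap.toMatrix_pow, LinearMap.toMatrix_mulVec_repr]
      rfl
    simp only [h1]
    rw [← map_sum, LinearEquiv.map_eq_zero_iff]
  refine ⟨l, hl, fun k v hinf q => ?_⟩
  simp only [key] at hinf ⊢
  exact h k _ hinf q

end Rational

open scoped TensorProduct in
/-- The Skolem–Mahler–Lech theorem for sums of orbits of injective endomorphisms of a torsion-free
abelian group of finite rank. -/
theorem exists_period_of_finite_rank {Γ : Type*} [AddCommGroup Γ] [Module.IsTorsionFree ℤ Γ]
    {d : ℕ} (hd : ∀ χ : Fin (d + 1) → Γ, ¬ LinearIndependent ℤ χ) {s : ℕ}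
    (A : Fin s → Module.End ℤ Γ) (hA : ∀ i, Function.Injective (A i)) :
    ∃ l : ℕ, 1 ≤ l ∧ ∀ (k : ℕ) (v : Fin s → Γ),
      {q : ℕ | ∑ i, (A i ^ (l * q + k)) (v i) = 0}.Infinite →
        ∀ q, ∑ i, (A i ^ (l * q + k)) (v i) = 0 := by
  have hrank : Module.rank ℤ Γ ≤ d := rank_le fun t ht => by
    by_contra! hcard
    obtain ⟨t', ht', hc⟩ := Finset.exists_subset_card_eq (Nat.succ_le_of_lt hcard)
    let e : Fin (d + 1) ≃ t' := (t'.equivFinOfCardEq hc).symm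
    refine hd (fun i => (e i : Γ)) ?_
    exact ht.comp (fun i : Fin (d + 1) => (⟨e i, ht' (e i).2⟩ : t)) fun a b hab => by
      simpa [Subtype.ext_iff] using hab
  let ι : Γ →ₗ[ℤ] TensorProduct ℤ ℚ Γ := TensorProduct.mk ℤ ℚ Γ 1
  have hfin : FiniteDimensional ℚ (TensorProduct ℤ ℚ Γ) := by
    rw [FiniteDimensional, ← Module.rank_lt_aleph0_iff]
    have h1 := (TensorProduct.isBaseChange ℤ Γ ℚ).rank_eq
    rw [h1]
    exact hrank.trans_lt (Cardinal.natCast_lt_aleph0)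
  -- Torsion-free ℤ-modules are flat, so Γ embeds in ℚ ⊗ Γ and no zeros of the sum are gained.
  have hι : Function.Injective ι := by
    have h1 := Module.Flat.rTensor_preserves_injective_linearMap (M := Γ)
      (Algebra.linearMap ℤ ℚ) (algebraMap ℤ ℚ).injective_int
    have h2 : ι = (Algebra.linearMap ℤ ℚ).rTensor Γ ∘ₗ (TensorProduct.lid ℤ Γ).symm := by
      refine LinearMap.ext fun x => ?_
      change (1 : ℚ) ⊗ₜ[ℤ] x = (Algebra.linearMap ℤ ℚ).rTensor Γ ((1 : ℤ) ⊗ₜ[ℤ] x)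
      rw [LinearMap.rTensor_tmul, Algebra.linearMap_apply, map_one]
    rw [h2]
    exact h1.comp (TensorProduct.lid ℤ Γ).symm.injective
  obtain ⟨l, hl, h⟩ := exists_period_linearMap (fun i => (A i).baseChange ℚ) fun i =>
    Module.Flat.lTensor_preserves_injective_linearMap (A i) (hA i)
  have key : ∀ (n : ℕ) (v : Fin s → Γ), ∑ i, (A i ^ n) (v i) = 0 ↔
      ∑ i, ((A i).baseChange ℚ ^ n) (ι (v i)) = 0 := fun n v => by
    have h1 : ∀ i, ((A i).baseChange ℚ ^ n) (ι (v i)) = ι ((A i ^ n) (v i)) := fun i => by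
      rw [← LinearMap.baseChange_pow]
      rfl
    simp only [h1]
    rw [← map_sum, map_eq_zero_iff ι hι]
  refine ⟨l, hl, fun k v hinf q => ?_⟩
  simp only [key] at hinf ⊢
  exact h k _ hinf q

/-! ### Endomorphisms of the dual group, and its torsion-freeness. -/

section DualMap

variable {X : Type*} [CommGroup X] [TopologicalSpace X]

/-- The endomorphism of the dual group induced by an endomorphism. -/
noncomputable def dualEnd (T : X →ₜ* X) : Module.End ℤ (Additive (X →ₜ* Circle)) :=
  AddMonoidHom.toIntLinearMap <| MonoidHom.toAdditive
    { toFun := fun χ => χ.comp T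
      map_one' := rfl
      map_mul' := fun _ _ => rfl }

theorem dualEnd_pow_apply (T : X →ₜ* X) (n : ℕ) (χ : Additive (X →ₜ* Circle)) (x : X) :
    ((dualEnd T ^ n) χ).toMul x = χ.toMul (T^[n] x) := by
  induction n generalizing χ with
  | zero => rfl
  | succ n ih =>
    rw [pow_succ, Module.End.mul_apply, ih, Function.iterate_succ_apply']
    rfl

theorem dualEnd_injective {T : X →ₜ* X} (hT : Function.Surjective T) :
    Function.Injective (dualEnd T) := fun χ ψ h => by
  refine Additive.toMul.injective (DFunLike.ext _ _ fun y => ?_)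
  obtain ⟨x, rfl⟩ := hT y
  exact DFunLike.congr_fun (congrArg Additive.toMul h) x

/-- The dual of a connected group is torsion-free. -/
theorem isTorsionFree_dual [ConnectedSpace X] :
    Module.IsTorsionFree ℤ (Additive (X →ₜ* Circle)) := by
  refine Module.IsTorsionFree.of_smul_eq_zero fun n χ h => ?_
  by_contra! hcon
  obtain ⟨hn, hχ⟩ := hcon
  have h1 : n.natAbs • χ = 0 := by
    rcases Int.natAbs_eq n with h2 | h2 <;> rw [h2] at h <;> simpa using h
  have h2 : ∀ x, χ.toMul x ^ n.natAbs = 1 := fun x => by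
    have h3 := DFunLike.congr_fun (congrArg Additive.toMul h1) x
    rwa [toMul_nsmul, ContinuousMonoidHom.pow_apply] at h3
  -- A torsion character takes values in roots of unity of a fixed order; a connected finite image
  -- is a point.
  have hfin : (Set.range χ.toMul).Finite := by
    have h3 : ((Polynomial.nthRoots n.natAbs (1 : ℂ)).toFinset : Set ℂ).Finite :=
      Finset.finite_toSet _
    refine (h3.preimage (f := fun z : Circle => (z : ℂ)) Circle.coe_injective.injOn).subset ?_
    rintro _ ⟨x, rfl⟩
    simp only [Set.mem_preimage, Finset.mem_coe, Multiset.mem_toFinset]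
    rw [Polynomial.mem_nthRoots (Int.natAbs_pos.2 hn), ← Circle.coe_pow, h2, Circle.coe_one]
  have hpre : IsPreconnected (Set.range χ.toMul) :=
    isPreconnected_range χ.toMul.continuous_toFun
  obtain ⟨x, hx⟩ := DFunLike.ne_iff.1 (show χ.toMul ≠ 1 from hχ)
  exact hpre.infinite_of_nontrivial ⟨_, ⟨x, rfl⟩, _, ⟨1, rfl⟩, by simpa using hx⟩ hfin

end DualMap

/-! ### Reduction from bounded functions to characters. -/

/-- A sequence which is a uniform limit of convergent sequences converges. -/
theorem exists_tendsto_of_forall_approx {F : Filter ℕ} [F.NeBot] {a : ℕ → ℂ}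
    (h : ∀ ε > 0, ∃ b : ℕ → ℂ, (∃ L, Tendsto b F (𝓝 L)) ∧ ∀ n, ‖a n - b n‖ ≤ ε) :
    ∃ L, Tendsto a F (𝓝 L) := by
  refine cauchy_map_iff_exists_tendsto.1 (Metric.cauchy_iff.2 ⟨inferInstance, fun ε hε => ?_⟩)
  obtain ⟨b, ⟨L, hL⟩, hab⟩ := h (ε / 4) (by positivity)
  refine ⟨Metric.ball L (ε / 2), ?_, fun x hx y hy => ?_⟩
  · rw [mem_map]
    filter_upwards [hL.eventually (Metric.ball_mem_nhds L (by positivity : 0 < ε / 4))] with n hn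
    rw [Set.mem_preimage, Metric.mem_ball]
    replace hn : dist (b n) L < ε / 4 := hn
    have h1 : dist (a n) (b n) ≤ ε / 4 := by
      rw [dist_eq_norm]
      exact hab n
    linarith [dist_triangle (a n) (b n) L]
  · rw [Metric.mem_ball] at hx hy
    linarith [dist_triangle_right x y L]

section Average

variable {X : Type*} [CommGroup X] [TopologicalSpace X] [IsTopologicalGroup X] [CompactSpace X]
  [T2Space X] [MeasurableSpace X] [BorelSpace X] (m : Measure X) [m.IsHaarMeasure]
  [IsProbabilityMeasure m] {s : ℕ} {T : Fin s → (X →ₜ* X)}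

theorem exists_bound_of_memLp_top {f : X → ℂ} (hf : MemLp f ⊤ m) :
    ∃ C : ℝ, 0 ≤ C ∧ ∀ᵐ x ∂m, ‖f x‖ ≤ C := by
  refine ⟨(eLpNorm f ⊤ m).toReal, ENNReal.toReal_nonneg, ?_⟩
  filter_upwards [ae_le_eLpNormEssSup (f := f) (μ := m)] with x hx
  rw [← toReal_enorm]
  exact ENNReal.toReal_mono hf.2.ne (by rwa [eLpNorm_exponent_top])

theorem memLp_top_continuousMap (g : C(X, ℂ)) : MemLp g ⊤ m :=
  memLp_top_of_bound g.continuous.aestronglyMeasurable ‖g‖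
    (Eventually.of_forall g.norm_coe_le_norm)

variable {m}

theorem measurePreserving_iterate [m.Regular] (hT : ∀ i, Function.Surjective (T i)) (i : Fin s)
    (n : ℕ) : MeasurePreserving (T i)^[n] m m :=
  (MonoidHom.measurePreserving (f := (T i).toMonoidHom) (T i).continuous_toFun (hT i) rfl).iterate n

theorem memLp_top_prod_comp (hT : ∀ i n, MeasurePreserving (T i)^[n] m m) {f : Fin s → X → ℂ}
    (hf : ∀ i, MemLp (f i) ⊤ m) (S : Finset (Fin s)) (n : ℕ) :
    MemLp (fun x => ∏ i ∈ S, f i ((T i)^[n] x)) ⊤ m := by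
  choose C hC0 hC using fun i => exists_bound_of_memLp_top m (hf i)
  refine memLp_top_of_bound (Finset.aestronglyMeasurable_fun_prod _ fun i _ =>
    (hf i).1.comp_measurePreserving (hT i n)) (∏ i ∈ S, C i) ?_
  have h1 : ∀ᵐ x ∂m, ∀ i, ‖f i ((T i)^[n] x)‖ ≤ C i :=
    eventually_all.2 fun i => (hT i n).quasiMeasurePreserving.ae (hC i)
  filter_upwards [h1] with x hx
  rw [norm_prod]
  exact Finset.prod_le_prod (fun _ _ => norm_nonneg _) fun i _ => hx i

theorem integrable_prod_comp (hT : ∀ i n, MeasurePreserving (T i)^[n] m m) {f : Fin s → X → ℂ}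
    (hf : ∀ i, MemLp (f i) ⊤ m) (n : ℕ) :
    Integrable (fun x => ∏ i, f i ((T i)^[n] x)) m :=
  (memLp_top_prod_comp hT hf Finset.univ n).integrable le_top

theorem prod_update_comp (f : Fin s → X → ℂ) (i : Fin s) (g : X → ℂ) (n : ℕ) (x : X) :
    ∏ j, Function.update f i g j ((T j)^[n] x) =
      g ((T i)^[n] x) * ∏ j ∈ Finset.univ.erase i, f j ((T j)^[n] x) := by
  rw [← Finset.mul_prod_erase _ _ (Finset.mem_univ i), Function.update_self]
  congr 1
  exact Finset.prod_congr rfl fun j hj => by rw [Function.update_of_ne (Finset.ne_of_mem_erase hj)]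

/-- One factor at a time is approximated in L¹ by trigonometric polynomials while the others stay
essentially bounded. Since the iterates preserve `m`, the error is uniform in n, and uniform limits
of convergent sequences converge. -/
theorem exists_tendsto_of_characters [m.Regular] (hT : ∀ i n, MeasurePreserving (T i)^[n] m m)
    {F : Filter ℕ} [F.NeBot]
    (hχ : ∀ χ : Fin s → (X →ₜ* Circle),
      ∃ L : ℂ, Tendsto (fun n : ℕ => ∫ x, ∏ i, (χ i ((T i)^[n] x) : ℂ) ∂m) F (𝓝 L))
    (f : Fin s → X → ℂ) (hf : ∀ i, MemLp (f i) ⊤ m) :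
    ∃ L : ℂ, Tendsto (fun n : ℕ => ∫ x, ∏ i, f i ((T i)^[n] x) ∂m) F (𝓝 L) := by
  refine forall_family_of_forall_update
    (fun f : Fin s → X → ℂ => ∃ L : ℂ, Tendsto (fun n : ℕ => ∫ x, ∏ i, f i ((T i)^[n] x) ∂m) F (𝓝 L))
    {f | MemLp f ⊤ m} (Set.range fun (χ : X →ₜ* Circle) x => (χ x : ℂ)) ?_
    (fun f hf i hP => ?_) (fun f hf => ?_) f hf
  · rintro _ ⟨χ, rfl⟩
    exact memLp_top_continuousMap m (charCM χ)
  swap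
  · choose χ hf using hf
    obtain rfl : (fun i x => (χ i x : ℂ)) = f := funext hf
    exact hχ χ
  simp only [prod_update_comp] at hP
  have hint : ∀ {g : X → ℂ}, MemLp g ⊤ m → ∀ n, Integrable (fun x => g ((T i)^[n] x) *
      ∏ j ∈ Finset.univ.erase i, f j ((T j)^[n] x)) m := fun {g} hg n => by
    have h1 := integrable_prod_comp hT (f := Function.update f i g) (fun j => by
      rcases eq_or_ne j i with rfl | hj
      · simpa using hg
      · simpa [hj] using hf j) n
    simpa only [prod_update_comp] using h1
  have hpoly : ∀ g ∈ Submodule.span ℂ (Set.range (charCM (X := X))), ∃ L : ℂ,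
      Tendsto (fun n : ℕ => ∫ x, g ((T i)^[n] x) *
        ∏ j ∈ Finset.univ.erase i, f j ((T j)^[n] x) ∂m) F (𝓝 L) := fun g hg => by
    refine Submodule.span_induction ?_ ⟨0, by simp⟩ ?_ ?_ hg
    · rintro _ ⟨χ, rfl⟩
      exact hP _ ⟨χ, rfl⟩
    · rintro g h - - ⟨L, hL⟩ ⟨L', hL'⟩
      refine ⟨L + L', (hL.add hL').congr fun n => ?_⟩
      rw [← integral_add (hint (memLp_top_continuousMap m g) n)
        (hint (memLp_top_continuousMap m h) n)]
      simp only [ContinuousMap.add_apply, add_mul]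
    · rintro c g - ⟨L, hL⟩
      refine ⟨c * L, (hL.const_mul c).congr fun n => ?_⟩
      rw [← integral_const_mul]
      simp only [ContinuousMap.smul_apply, smul_eq_mul, mul_assoc]
  choose C hC0 hC using fun j => exists_bound_of_memLp_top m (hf j)
  set K := ∏ j ∈ Finset.univ.erase i, C j
  have hK : 0 ≤ K := Finset.prod_nonneg fun j _ => hC0 j
  have hWK : ∀ n, ∀ᵐ x ∂m, ‖∏ j ∈ Finset.univ.erase i, f j ((T j)^[n] x)‖ ≤ K := fun n => by
    have h1 : ∀ᵐ x ∂m, ∀ j, ‖f j ((T j)^[n] x)‖ ≤ C j :=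
      eventually_all.2 fun j => (hT j n).quasiMeasurePreserving.ae (hC j)
    filter_upwards [h1] with x hx
    rw [norm_prod]
    exact Finset.prod_le_prod (fun _ _ => norm_nonneg _) fun j _ => hx j
  refine exists_tendsto_of_forall_approx fun ε hε => ?_
  have hfi : Integrable (f i) m := (hf i).integrable le_top
  -- First L¹ approximation by a continuous function, then uniform approximation by a trigonometric
  -- polynomial. The denominator K + 1 avoids division by K = 0.
  obtain ⟨g, hg, hgspan⟩ : ∃ g : C(X, ℂ), ∫ x, ‖f i x - g x‖ ∂m ≤ ε / (K + 1) ∧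
      g ∈ Submodule.span ℂ (Set.range (charCM (X := X))) := by
    obtain ⟨g0, -, hg0, hg0c, hg0i⟩ := hfi.exists_hasCompactSupport_integral_sub_le
      (show 0 < ε / (K + 1) / 2 by positivity)
    obtain ⟨g, hgspan, hg⟩ := (dense_span_charCM m).exists_dist_lt (⟨g0, hg0c⟩ : C(X, ℂ))
      (show 0 < ε / (K + 1) / 2 by positivity)
    refine ⟨g, ?_, hgspan⟩
    have hgi : Integrable g m := (memLp_top_continuousMap m g).integrable le_top
    have h1 : ∀ x, ‖f i x - g x‖ ≤ ‖f i x - g0 x‖ + ε / (K + 1) / 2 := fun x => by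
      have h2 := (ContinuousMap.norm_coe_le_norm ((⟨g0, hg0c⟩ : C(X, ℂ)) - g) x).trans
        (dist_eq_norm (⟨g0, hg0c⟩ : C(X, ℂ)) g ▸ hg.le)
      have h3 : f i x - g x = (f i x - g0 x) + (g0 x - g x) := by ring
      rw [h3]
      exact (norm_add_le _ _).trans (add_le_add le_rfl h2)
    calc ∫ x, ‖f i x - g x‖ ∂m ≤ ∫ x, (‖f i x - g0 x‖ + ε / (K + 1) / 2) ∂m :=
          integral_mono (hfi.sub hgi).norm ((hfi.sub hg0i).norm.add (integrable_const _)) h1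
      _ = ∫ x, ‖f i x - g0 x‖ ∂m + ε / (K + 1) / 2 := by
          have h2 : Integrable (fun x => ‖f i x - g0 x‖) m := (hfi.sub hg0i).norm
          rw [integral_add h2 (integrable_const _)]
          simp
      _ ≤ ε / (K + 1) := by linarith
  refine ⟨_, hpoly g hgspan, fun n => ?_⟩
  have hsub : MemLp (fun x => f i x - g x) ⊤ m := (hf i).sub (memLp_top_continuousMap m g)
  have hself : ∀ x, ∏ j, f j ((T j)^[n] x) = f i ((T i)^[n] x) *
      ∏ j ∈ Finset.univ.erase i, f j ((T j)^[n] x) := fun x =>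
    (Finset.mul_prod_erase _ _ (Finset.mem_univ i)).symm
  simp only [hself]
  rw [← integral_sub (hint (hf i) n) (hint (memLp_top_continuousMap m g) n)]
  simp only [← sub_mul]
  have hcomp : ∫ x, ‖f i ((T i)^[n] x) - g ((T i)^[n] x)‖ ∂m = ∫ x, ‖f i x - g x‖ ∂m := by
    have h1 : AEStronglyMeasurable (fun x => ‖f i x - g x‖) (m.map (T i)^[n]) := by
      rw [(hT i n).map_eq]
      exact hsub.1.norm
    have h2 := integral_map (hT i n).measurable.aemeasurable h1
    rw [(hT i n).map_eq] at h2
    exact h2.symm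
  have hcompi : Integrable (fun x => ‖f i ((T i)^[n] x) - g ((T i)^[n] x)‖) m :=
    ((hsub.comp_measurePreserving (hT i n)).integrable le_top).norm
  calc _ ≤ ∫ x, ‖(f i ((T i)^[n] x) - g ((T i)^[n] x)) *
          ∏ j ∈ Finset.univ.erase i, f j ((T j)^[n] x)‖ ∂m := norm_integral_le_integral_norm _
    _ ≤ ∫ x, ‖f i ((T i)^[n] x) - g ((T i)^[n] x)‖ * K ∂m := by
        refine integral_mono_ae (hint hsub n).norm (hcompi.mul_const K) ?_
        filter_upwards [hWK n] with x hx
        rw [norm_mul]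
        gcongr
    _ = (∫ x, ‖f i x - g x‖ ∂m) * K := by rw [integral_mul_const, hcomp]
    _ ≤ ε / (K + 1) * K := by gcongr
    _ ≤ ε := by
        rw [div_mul_eq_mul_div, div_le_iff₀ (by positivity)]
        nlinarith

end Average

/-! ### Conclusion. -/

theorem mainTheorem6 {X : Type*} [CommGroup X] [TopologicalSpace X] [IsTopologicalGroup X]
    [CompactSpace X] [T2Space X] [ConnectedSpace X]
    (hdim : coveringDim X < ⊤)
    [MeasurableSpace X] [BorelSpace X]
    (m : Measure X) [m.IsHaarMeasure] [m.Regular] [IsProbabilityMeasure m]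
    (s : ℕ) (T : Fin s → (X →ₜ* X)) (hT : ∀ i, Function.Surjective (T i)) :
    ∃ l : ℕ, 1 ≤ l ∧ ∀ (k : ZMod l) (f : Fin s → X → ℂ), (∀ i, MemLp (f i) ⊤ m) →
      (∀ n : ℕ, Integrable (fun x => ∏ i, f i ((T i)^[n] x)) m) ∧
      ∃ L : ℂ, Tendsto (fun n : ℕ => ∫ x, ∏ i, f i ((T i)^[n] x) ∂m)
        (atTop ⊓ 𝓟 {n : ℕ | (n : ZMod l) = k}) (𝓝 L) := by
  obtain ⟨d, hd⟩ : ∃ d, CoveringDimLE X d := by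
    simpa [coveringDim, iInf_lt_iff] using hdim
  have := isTorsionFree_dual (X := X)
  obtain ⟨l, hl, hSML⟩ := exists_period_of_finite_rank
    (not_linearIndependent_of_coveringDimLE m hd) (fun i => dualEnd (T i))
    fun i => dualEnd_injective (hT i)
  have hmp := measurePreserving_iterate (m := m) hT
  refine ⟨l, hl, fun k f hf => ⟨integrable_prod_comp hmp hf, ?_⟩⟩
  have : NeZero l := ⟨by omega⟩
  have hmem : ∀ n : ℕ, (n : ZMod l) = k → n = l * (n / l) + k.val := fun n hn => by
    rw [← hn, ZMod.val_natCast, Nat.div_add_mod]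
  have hclass : ∀ q : ℕ, ((l * q + k.val : ℕ) : ZMod l) = k := fun q => by simp
  have hneBot : (atTop ⊓ 𝓟 {n : ℕ | (n : ZMod l) = k}).NeBot := by
    rw [← frequently_mem_iff_neBot, frequently_atTop]
    exact fun a => ⟨l * a + k.val, by nlinarith, hclass a⟩
  refine exists_tendsto_of_characters hmp (fun χ => ?_) f hf
  let Ψ : ℕ → Additive (X →ₜ* Circle) := fun n =>
    ∑ i, (dualEnd (T i) ^ n) (Additive.ofMul (χ i))
  have hΨ : ∀ n x, ∏ i, (χ i ((T i)^[n] x) : ℂ) = ((Ψ n).toMul x : ℂ) := fun n x => by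
    have h1 : ∀ S : Finset (Fin s), ∏ i ∈ S, (χ i ((T i)^[n] x) : ℂ) =
        ((∑ i ∈ S, (dualEnd (T i) ^ n) (Additive.ofMul (χ i))).toMul x : ℂ) := fun S => by
      induction S using Finset.induction_on with
      | empty => simp
      | insert a S ha ih =>
        rw [Finset.prod_insert ha, Finset.sum_insert ha, ih, toMul_add,
          ContinuousMonoidHom.mul_apply, Circle.coe_mul, dualEnd_pow_apply, toMul_ofMul]
    exact h1 Finset.univ
  simp only [hΨ]
  -- Infinitely many zeros in the class force Ψ to vanish on all of it, giving limit 1; otherwise Ψ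
  -- is eventually nonzero there and the integrals are eventually 0.
  by_cases hinf : {q : ℕ | Ψ (l * q + k.val) = 0}.Infinite
  · refine ⟨1, tendsto_const_nhds.congr' ?_⟩
    filter_upwards [mem_inf_of_right (mem_principal_self _)] with n hn
    have h1 : Ψ n = 0 := by
      rw [hmem n hn]
      exact hSML k.val _ hinf _
    simp [h1]
  · refine ⟨0, tendsto_const_nhds.congr' ?_⟩
    have hfin := ((Set.not_infinite.1 hinf).image fun q => l * q + k.val).eventually_cofinite_notMem
    rw [Nat.cofinite_eq_atTop] at hfin
    filter_upwards [mem_inf_of_left hfin, mem_inf_of_right (mem_principal_self _)] with n hn hnk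
    refine (integral_charCM_of_ne_one m fun h0 => hn ⟨n / l, ?_, (hmem n hnk).symm⟩).symm
    rw [Set.mem_setOf_eq, ← hmem n hnk]
    exact h0
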